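/- In this statement graphs are finite, may have multiple edges, and have no loops; $d_G(v)$ denotes the degree of $v$ in $G$. A graph $G$ is $m$-edge-connected if for every set $X$ with $\emptyset\subsetneq X\subsetneq V(G)$ at least $m$ edges have exactly one end in $X$. The bipartite index $bi(G)$ is the smallest value of $|E(G)\setminus E(H)|$ over all bipartite spanning subgraphs $H$ of $G$. For $f:V(G)\to \mathbb{Z}/k\mathbb{Z}$, an $f$-factor of $G$ is a spanning subgraph $H$ of $G$ with $d_H(v)\equiv f(v) \pmod k$ for every vertex $v$. **Theorem.** Let $G$ be a non-bipartite graph, let $k\ge 3$ be an integer, and let $f:V(G)\to\mathbb{Z}/k\mathbb{Z}$ be a mapping such that $\sum_{v\in V(G)}f(v)\equiv 0\pmod 2$ if $k$ is even. Assume that $bi(G)\ge k-1$ if $k$ is odd and $bi(G)\ge k/2-1$ if $k$ is even. If $G$ is $(6k-7)$-edge-connected, then $G$ has an $f$-factor $H$ such that for every vertex $v$, $$\Big\lfloor \frac{d_G(v)}{2}\Big\rfloor-k-\frac k4+\frac14\;\le\; d_H(v)\;\le\;\Big\lceil \frac{d_G(v)}{2}\Big\rceil+k+\frac k4-\frac14\qquad\text{if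 $k$ is even},$$ $$\Big\lfloor \frac{d_G(v)}{2}\Big\rfloor-\frac{3k}2\;\le\; d_H(v)\;\le\;\Big\lceil \frac{d_G(v)}{2}\Big\rceil+\frac{3k}2\qquad\text{if $k$ is odd}.$$ -/

import Mathlib

open scoped Graph

namespace Graph

/-- The degree of the vertex `v` in the multigraph `G`: the number of edges incident with `v`,
loops being counted twice. -/
noncomputable def degree {α β : Type*} (G : Graph α β) (v : α) : ℕ :=
  (G.incidenceSet v).ncard + (G.loopSet v).ncard

/-- The set of edges of `G` with exactly one end in `X`. -/
def edgeCut {α β : Type*} (G : Graph α β) (X : Set α) : Set β :=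
  {e | ∃ x y, G.IsLink e x y ∧ x ∈ X ∧ y ∉ X}

/-- `G` is `m`-edge-connected: every nonempty proper set of vertices is left by at least `m`
edges. -/
def IsEdgeConnected {α β : Type*} (G : Graph α β) (m : ℕ) : Prop :=
  ∀ X : Set α, X ⊆ V(G) → X.Nonempty → X ≠ V(G) → m ≤ (G.edgeCut X).ncard

/-- `G` is bipartite: its vertex set is the disjoint union of two (possibly empty) sets such that
every edge has one end in each of them. -/
def IsBipartite {α β : Type*} (G : Graph α β) : Prop :=
  ∃ A B : Set α, Disjoint A B ∧ A ∪ B = V(G) ∧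
    ∀ e x y, G.IsLink e x y → (x ∈ A ∧ y ∈ B) ∨ (x ∈ B ∧ y ∈ A)

/-- The bipartite index of `G`: the smallest value of `|E(G) \ E(H)|` over all bipartite spanning
subgraphs `H` of `G`. -/
noncomputable def bipartiteIndex {α β : Type*} (G : Graph α β) : ℕ :=
  sInf {n : ℕ | ∃ H : Graph α β, H ≤s G ∧ H.IsBipartite ∧ n = (E(G) \ E(H)).ncard}

/-- `H` is an `f`-factor of `G` modulo `k`: a spanning subgraph of `G` in which the degree of each
vertex `v` is congruent to `f v` modulo `k`. -/
def IsFactorMod {α β : Type*} (G : Graph α β) {k : ℕ} (f : α → ZMod k) (H : Graph α β) : Prop :=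
  H ≤s G ∧ ∀ v ∈ V(G), (H.degree v : ZMod k) = f v

end Graph

-- Choosing a spanning subgraph amounts to signing the edges by `±1` and keeping those of sign `1`:
-- twice the degree of `v` in the subgraph, minus its degree in the graph, is the sum of the signs
-- at `v`. So the signs at `v` must have a sum congruent to `2 f(v) - d(v)` modulo `2k` and of
-- absolute value at most `2k - 1 + m`, where `m` is `k` for odd `k` and `k/2` for even `k`.
--
-- For the edges across a partition of the vertices into two classes, signings and orientations are
-- the same thing up to a factor `±1` depending on the class. The edges `B` of a maximum cut contain
-- at least half of every edge cut, so they form a `(3k-3)`-edge-connected graph, and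
-- `exists_orientation` realises prescribed net out-degrees modulo `2k` on it, provided that they
-- have the right parities and their total vanishes modulo `2k`. The edges `M` inside the classes,
-- at least `m - 1` of them by the bipartite index, are signed so as to correct the total
-- (`exists_small_solution`, `exists_signs_sum_eq`). Their contribution at a vertex must not exceed
-- `m`. Hence `exists_signs` pairs off adjacent edges of `M` while there are more than `m` of them:
-- with opposite signs, two edges `uv` and `vw` act like one oriented edge `uw`.
--
-- The orientation theorem is proved in the stronger form `Preoriented.hasExtension`, where the
-- edges at one vertex `z` are oriented in advance and the lower bound for a cut depends on the
-- distance of its boundary from the multiples of `2k`. The induction is on the number of vertices.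
-- A set meeting its bound with equality splits the problem into two contractions. Otherwise parity
-- gives every set of at least two vertices a slack of two, which pays either for lifting two edges
-- at a vertex of zero boundary, or for deleting an edge directed from a vertex of positive boundary
-- to one of negative boundary.

universe u v

/-! ### Distance to the multiples of `2k`. -/

/-- The distance from `x` to the nearest multiple of `2 * k`. -/
def circNorm (k x : ℤ) : ℤ := min (x % (2 * k)) (2 * k - x % (2 * k))

lemma circNorm_le_abs_sub {k : ℤ} (hk : 0 < k) (x j : ℤ) : circNorm k x ≤ |x - 2 * k * j| := by
  have h1 := Int.emod_nonneg x (show (2 * k) ≠ 0 by omega)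
  have h2 := Int.emod_lt_of_pos x (show 0 < 2 * k by omega)
  have h3 := Int.emod_add_mul_ediv x (2 * k)
  have h4 : x - 2 * k * j = x % (2 * k) + 2 * k * (x / (2 * k) - j) := by linarith
  unfold circNorm
  rw [h4]
  rcases le_or_gt 0 (x / (2 * k) - j) with h | h
  · refine (min_le_left _ _).trans (le_trans ?_ (le_abs_self _))
    nlinarith
  · refine (min_le_right _ _).trans (le_trans ?_ (neg_le_abs _))
    nlinarith

lemma exists_circNorm_eq (k x : ℤ) (hk : 0 < k) : ∃ j, circNorm k x = |x - 2 * k * j| := by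
  have h1 := Int.emod_nonneg x (show (2 * k) ≠ 0 by omega)
  have h2 := Int.emod_lt_of_pos x (show 0 < 2 * k by omega)
  have h3 := Int.emod_add_mul_ediv x (2 * k)
  rcases le_total (x % (2 * k)) (2 * k - x % (2 * k)) with h | h
  · refine ⟨x / (2 * k), ?_⟩
    rw [circNorm, min_eq_left h, show x - 2 * k * (x / (2 * k)) = x % (2 * k) by linarith,
      abs_of_nonneg h1]
  · refine ⟨x / (2 * k) + 1, ?_⟩
    rw [circNorm, min_eq_right h,
      show x - 2 * k * (x / (2 * k) + 1) = -(2 * k - x % (2 * k)) by linarith, abs_neg,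
      abs_of_nonneg (by omega)]

lemma circNorm_nonneg {k : ℤ} (hk : 0 < k) (x : ℤ) : 0 ≤ circNorm k x := by
  obtain ⟨j, hj⟩ := exists_circNorm_eq k x hk
  rw [hj]; exact abs_nonneg _

lemma circNorm_le {k : ℤ} (x : ℤ) : circNorm k x ≤ k := by
  unfold circNorm; omega

lemma circNorm_add_le {k : ℤ} (hk : 0 < k) (x y : ℤ) : circNorm k (x + y) ≤ circNorm k x + |y| := by
  obtain ⟨j, hj⟩ := exists_circNorm_eq k x hk
  rw [hj]
  refine (circNorm_le_abs_sub hk _ j).trans ?_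
  rw [show x + y - 2 * k * j = (x - 2 * k * j) + y by ring]
  exact abs_add_le _ _

lemma circNorm_congr {k x y : ℤ} (h : 2 * k ∣ x - y) : circNorm k x = circNorm k y := by
  unfold circNorm
  rw [(Int.emod_emod_of_dvd x dvd_rfl).symm, (Int.emod_emod_of_dvd y dvd_rfl).symm,
    Int.emod_emod_of_dvd x dvd_rfl, Int.emod_emod_of_dvd y dvd_rfl,
    Int.emod_eq_emod_iff_emod_sub_eq_zero.2 (Int.emod_eq_zero_of_dvd h)]

lemma circNorm_neg_le {k : ℤ} (hk : 0 < k) (x : ℤ) : circNorm k (-x) ≤ circNorm k x := by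
  obtain ⟨j, hj⟩ := exists_circNorm_eq k x hk
  rw [hj, ← abs_neg (x - _)]
  refine (circNorm_le_abs_sub hk _ (-j)).trans (le_of_eq ?_)
  congr 1; ring

lemma circNorm_neg {k : ℤ} (hk : 0 < k) (x : ℤ) : circNorm k (-x) = circNorm k x :=
  le_antisymm (circNorm_neg_le hk x) (by simpa using circNorm_neg_le hk (-x))

lemma circNorm_of_nonneg {k x : ℤ} (h0 : 0 ≤ x) (h : x ≤ k) : circNorm k x = x := by
  rcases h0.lt_or_eq with h1 | h1
  · unfold circNorm
    rw [Int.emod_eq_of_lt h0 (by omega)]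
    omega
  · subst h1
    simp [circNorm]; omega

lemma circNorm_eq_zero_iff {k x : ℤ} (hk : 0 < k) : circNorm k x = 0 ↔ 2 * k ∣ x := by
  constructor
  · intro h
    obtain ⟨j, hj⟩ := exists_circNorm_eq k x hk
    rw [h] at hj
    exact ⟨j, by linarith [abs_eq_zero.1 hj.symm]⟩
  · intro h
    rw [circNorm_congr (y := 0) (by simpa using h)]
    exact circNorm_of_nonneg le_rfl hk.le

lemma two_dvd_circNorm_sub {k : ℤ} (hk : 0 < k) (x : ℤ) : (2 : ℤ) ∣ circNorm k x - x := by
  obtain ⟨j, hj⟩ := exists_circNorm_eq k x hk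
  rw [hj]
  rcases abs_choice (x - 2 * k * j) with h | h <;> rw [h]
  · exact ⟨-(k * j), by ring⟩
  · exact ⟨k * j - x, by ring⟩

/-- An integer whose absolute value is small compared with its residue norm is less than `2 * k`. -/
lemma abs_lt_of_le_circNorm {k x : ℤ} (hk : 0 < k) (h : |x| ≤ 2 * k - 2 + circNorm k x) :
    |x| < 2 * k := by
  by_contra hx
  push Not at hx
  rcases le_total 0 x with h0 | h0
  · rw [abs_of_nonneg h0] at h hx
    have := circNorm_le_abs_sub hk x 1
    rw [abs_of_nonneg (by linarith)] at this
    linarith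
  · rw [abs_of_nonpos h0] at h hx
    have := circNorm_le_abs_sub hk x (-1)
    rw [abs_of_nonpos (by linarith)] at this
    linarith

/-! ### Cuts, net out-degrees and preoriented graphs. -/

section EdgeSystems

variable {V : Type u} [DecidableEq V] {E : Type v}

/-- The integer-valued indicator function of a finite set. -/
def ind (A : Finset V) (x : V) : ℤ := if x ∈ A then 1 else 0

/-- The number of edges of `F` with exactly one end in `A`, where `s e` and `t e` are the ends of
the edge `e`. -/
def cutSize (F : Finset E) (s t : E → V) (A : Finset V) : ℤ :=
  ∑ e ∈ F, |ind A (s e) - ind A (t e)|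

/-- The number of edges leaving `A` minus the number of edges entering `A`, where `e` is directed
from `s e` to `t e` if `σ e = 1` and from `t e` to `s e` if `σ e = -1`. -/
def netOut (F : Finset E) (s t : E → V) (σ : E → ℤ) (A : Finset V) : ℤ :=
  ∑ e ∈ F, σ e * (ind A (s e) - ind A (t e))

lemma ind_cases (A : Finset V) (x : V) : ind A x = 0 ∨ ind A x = 1 := by
  unfold ind; split_ifs <;> simp

lemma ind_of_mem {A : Finset V} {x : V} (h : x ∈ A) : ind A x = 1 := by simp [ind, h]

lemma ind_of_notMem {A : Finset V} {x : V} (h : x ∉ A) : ind A x = 0 := by simp [ind, h]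

lemma ind_singleton (v x : V) : ind {v} x = if x = v then 1 else 0 := by simp [ind]

lemma sum_ind_singleton (A : Finset V) (x : V) : ∑ v ∈ A, ind {v} x = ind A x := by
  simp [ind]

lemma abs_ind_sub_le (A : Finset V) (x y : V) : |ind A x - ind A y| ≤ 1 := by
  rcases ind_cases A x with h | h <;> rcases ind_cases A y with h' | h' <;> simp [h, h']

lemma cutSize_nonneg (F : Finset E) (s t : E → V) (A : Finset V) : 0 ≤ cutSize F s t A :=
  Finset.sum_nonneg fun _ _ => abs_nonneg _

lemma abs_netOut_le (F : Finset E) (s t : E → V) {σ : E → ℤ} (hσ : ∀ e, σ e = 1 ∨ σ e = -1)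
    (A : Finset V) : |netOut F s t σ A| ≤ cutSize F s t A := by
  refine (Finset.abs_sum_le_sum_abs _ _).trans (Finset.sum_le_sum fun e _ => ?_)
  rcases hσ e with h | h <;> simp [h, abs_sub_comm]

lemma sum_netOut_singleton (F : Finset E) (s t : E → V) (σ : E → ℤ) (A : Finset V) :
    ∑ v ∈ A, netOut F s t σ {v} = netOut F s t σ A := by
  unfold netOut
  rw [Finset.sum_comm]
  refine Finset.sum_congr rfl fun e _ => ?_
  rw [← Finset.mul_sum, Finset.sum_sub_distrib, sum_ind_singleton, sum_ind_singleton]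

lemma netOut_eq_zero {F : Finset E} {s t : E → V} {S : Finset V} (hs : ∀ e ∈ F, s e ∈ S)
    (ht : ∀ e ∈ F, t e ∈ S) (σ : E → ℤ) : netOut F s t σ S = 0 :=
  Finset.sum_eq_zero fun e he => by simp [ind, hs e he, ht e he]

/-- A graph with vertex set `S`, edge set `F` and prescribed net out-degrees `β` modulo `2 * k`,
whose edges at `z` are oriented by `σ`, and with large edge cuts. The vertex `ex` is exempt from
the cut condition, unless `ex = z`. -/
structure Preoriented (k : ℤ) (S : Finset V) (F : Finset E) (s t : E → V) (σ : E → ℤ) (β : V → ℤ)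
    (z ex : V) : Prop where
  hz : z ∈ S
  hs : ∀ e ∈ F, s e ∈ S
  ht : ∀ e ∈ F, t e ∈ S
  hσ : ∀ e, σ e = 1 ∨ σ e = -1
  hsum : 2 * k ∣ ∑ v ∈ S, β v
  hpar : ∀ A ⊆ S, (2 : ℤ) ∣ cutSize F s t A - ∑ v ∈ A, β v
  hpre : 2 * k ∣ netOut F s t σ {z} - β z
  hdeg : cutSize F s t {z} ≤ 2 * k - 2 + circNorm k (β z)
  hcut : ∀ A ⊆ S, A.Nonempty → z ∉ A → (∃ x ∈ S, x ≠ z ∧ x ∉ A) → A ≠ {ex} →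
    2 * k - 2 + circNorm k (∑ v ∈ A, β v) ≤ cutSize F s t A
  hex : ex ≠ z → ex ∈ S ∧ 2 * k ∣ β ex

/-- The orientation of the edges at `z` extends to an orientation with net out-degrees congruent to
`β` modulo `2 * k` and smaller than `2 * k` in absolute value. -/
def HasExtension (k : ℤ) (S : Finset V) (F : Finset E) (s t : E → V) (σ : E → ℤ) (β : V → ℤ)
    (z : V) : Prop :=
  ∃ σ' : E → ℤ, (∀ e, σ' e = 1 ∨ σ' e = -1) ∧ (∀ e ∈ F, s e = z ∨ t e = z → σ' e = σ e) ∧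
    ∀ v ∈ S, 2 * k ∣ netOut F s t σ' {v} - β v ∧ |netOut F s t σ' {v}| < 2 * k

/-- Every preoriented graph with fewer than `n` vertices has an extension. -/
def ExtensionsBelow (V : Type u) [DecidableEq V] (k : ℤ) (n : ℕ) : Prop :=
  ∀ (E : Type v) (S : Finset V) (F : Finset E) (s t : E → V) (σ : E → ℤ) (β : V → ℤ) (z ex : V),
    S.card < n → Preoriented k S F s t σ β z ex → HasExtension k S F s t σ β z

variable {k : ℤ} {S : Finset V} {F : Finset E} {s t : E → V} {σ : E → ℤ} {β : V → ℤ} {z ex : V}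

/-- The degree of `z` may itself reach `2k` or more; it is the congruence with `β z` that excludes
large net out-degrees. -/
lemma Preoriented.abs_netOut_lt (hk : 0 < k) (h : Preoriented k S F s t σ β z ex) :
    |netOut F s t σ {z}| < 2 * k := by
  refine abs_lt_of_le_circNorm hk ((abs_netOut_le F s t h.hσ _).trans ?_)
  rw [circNorm_congr h.hpre]
  exact h.hdeg

lemma netOut_congr {σ' : E → ℤ} {A : Finset V}
    (h : ∀ e ∈ F, ind A (s e) ≠ ind A (t e) → σ e = σ' e) :
    netOut F s t σ A = netOut F s t σ' A := by
  refine Finset.sum_congr rfl fun e he => ?_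
  by_cases h' : ind A (s e) = ind A (t e)
  · simp [h']
  · rw [h e he h']

lemma ends_of_ind_singleton_ne {v x y : V} (h : ind {v} x ≠ ind {v} y) : x = v ∨ y = v := by
  by_contra! hc
  simp [ind_singleton, hc.1, hc.2] at h

/-! ### Contractions and tight sets. -/

section Contraction

variable (π : V → V)

lemma ind_filter {A : Finset V} {x : V} (hx : x ∈ S) :
    ind {y ∈ S | π y ∈ A} x = ind A (π x) := by
  simp [ind, hx]

lemma cutSize_comp (hs : ∀ e ∈ F, s e ∈ S) (ht : ∀ e ∈ F, t e ∈ S) (A : Finset V) :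
    cutSize F (π ∘ s) (π ∘ t) A = cutSize F s t {y ∈ S | π y ∈ A} :=
  Finset.sum_congr rfl fun e he => by
    rw [ind_filter π (hs e he), ind_filter π (ht e he)]; rfl

lemma netOut_comp (hs : ∀ e ∈ F, s e ∈ S) (ht : ∀ e ∈ F, t e ∈ S) (τ : E → ℤ) (A : Finset V) :
    netOut F (π ∘ s) (π ∘ t) τ A = netOut F s t τ {y ∈ S | π y ∈ A} :=
  Finset.sum_congr rfl fun e he => by
    rw [ind_filter π (hs e he), ind_filter π (ht e he)]; rfl

lemma sum_fibers (β : V → ℤ) (A : Finset V) :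
    ∑ w ∈ A, ∑ x ∈ S with π x = w, β x = ∑ x ∈ S with π x ∈ A, β x := by
  rw [← Finset.sum_fiberwise_of_maps_to (s := {x ∈ S | π x ∈ A}) (t := A) (g := π) (by simp)]
  refine Finset.sum_congr rfl fun w hw => Finset.sum_congr ?_ fun _ _ => rfl
  ext x
  simp only [Finset.mem_filter]
  constructor
  · rintro ⟨h1, h2⟩; exact ⟨⟨h1, h2 ▸ hw⟩, h2⟩
  · rintro ⟨⟨h1, _⟩, h2⟩; exact ⟨h1, h2⟩

/-- The image of a preoriented graph under a map of vertices. -/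
lemma Preoriented.map (h : Preoriented k S F s t σ β z ex) {σ' : E → ℤ}
    (hσ' : ∀ e, σ' e = 1 ∨ σ' e = -1) {z' ex' : V} (hz' : z' ∈ S.image π)
    (hpre : 2 * k ∣ netOut F s t σ' {x ∈ S | π x = z'} - ∑ x ∈ S with π x = z', β x)
    (hdeg : cutSize F s t {x ∈ S | π x = z'} ≤
      2 * k - 2 + circNorm k (∑ x ∈ S with π x = z', β x))
    (hcut : ∀ A ⊆ S.image π, z' ∉ A → (∃ x ∈ S.image π, x ≠ z' ∧ x ∉ A) → A ≠ {ex'} →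
      A.Nonempty → z ∉ {x ∈ S | π x ∈ A} ∧ (∃ x ∈ S, x ≠ z ∧ x ∉ {x ∈ S | π x ∈ A}) ∧
        {x ∈ S | π x ∈ A} ≠ {ex})
    (hex : ex' ≠ z' → ex' ∈ S.image π ∧ 2 * k ∣ ∑ x ∈ S with π x = ex', β x) :
    Preoriented k (S.image π) F (π ∘ s) (π ∘ t) σ' (fun w => ∑ x ∈ S with π x = w, β x) z' ex' where
  hz := hz'
  hs e he := Finset.mem_image_of_mem π (h.hs e he)
  ht e he := Finset.mem_image_of_mem π (h.ht e he)
  hσ := hσ'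
  hsum := by
    rw [sum_fibers, Finset.filter_true_of_mem fun x hx => Finset.mem_image_of_mem π hx]
    exact h.hsum
  hpar A _ := by
    rw [sum_fibers, cutSize_comp π h.hs h.ht]
    exact h.hpar _ (Finset.filter_subset _ _)
  hpre := by simpa [netOut_comp π h.hs h.ht] using hpre
  hdeg := by simpa [cutSize_comp π h.hs h.ht] using hdeg
  hcut A hA hne hzA hx hA' := by
    rw [sum_fibers, cutSize_comp π h.hs h.ht]
    obtain ⟨h1, h2, h3⟩ := hcut A hA hzA hx hA' hne
    refine h.hcut _ (Finset.filter_subset _ _) ?_ h1 h2 h3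
    obtain ⟨w, hw⟩ := hne
    obtain ⟨x, hx, rfl⟩ := Finset.mem_image.1 (hA hw)
    exact ⟨x, by simp [hx, hw]⟩
  hex := hex

end Contraction


lemma card_image_lt_of_collision {π : V → V} {a b : V} (ha : a ∈ S) (hb : b ∈ S) (hab : a ≠ b)
    (h : π a = π b) : (S.image π).card < S.card := by
  refine lt_of_le_of_ne Finset.card_image_le fun hc => hab ?_
  exact Finset.card_image_iff.1 hc ha hb h

/-- Contracting `A` orients all edges not inside `A`; contracting the complement of `A` into `z`
then makes the edges leaving `A` preoriented, and the rest follows by induction. Both contractions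
are proper, because `A` has two vertices and its complement has one besides `z`. -/
lemma Preoriented.hasExtension_of_tight (hk : 0 < k) (IH : ExtensionsBelow.{u, v} V k S.card)
    (h : Preoriented k S F s t σ β z ex) {A : Finset V} (hA : A ⊆ S) {a b : V} (ha : a ∈ A)
    (hb : b ∈ A) (hab : a ≠ b) (hzA : z ∉ A) (hx : ∃ x ∈ S, x ≠ z ∧ x ∉ A)
    (htight : cutSize F s t A = 2 * k - 2 + circNorm k (∑ v ∈ A, β v)) :
    HasExtension k S F s t σ β z := by
  have hne : A.Nonempty := ⟨a, ha⟩
  have hza : z ≠ a := fun hh => hzA (hh ▸ ha)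
  -- contract `A` to the vertex `a`
  obtain ⟨π₁, hπ₁⟩ : ∃ π : V → V, π = fun x => if x ∈ A then a else x := ⟨_, rfl⟩
  have fib₁ : ∀ v ∈ S, v ∉ A → {x ∈ S | π₁ x = v} = {v} := by
    intro v hv hvA
    ext x
    simp only [hπ₁, Finset.mem_filter, Finset.mem_singleton]
    constructor
    · rintro ⟨_, h2⟩
      split_ifs at h2 with hxA
      · exact absurd (h2 ▸ ha) hvA
      · exact h2
    · rintro rfl
      simp [hv, hvA]
  have fib₁a : {x ∈ S | π₁ x = a} = A := by
    ext x
    simp only [hπ₁, Finset.mem_filter]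
    constructor
    · rintro ⟨_, h2⟩
      split_ifs at h2 with hxA
      · exact hxA
      · exact h2 ▸ ha
    · intro hxA
      simp [hA hxA, hxA]
  have mem₁ : ∀ v ∈ S, v ∉ A → v ∈ S.image π₁ := fun v hv hvA =>
    Finset.mem_image.2 ⟨v, hv, by simp [hπ₁, hvA]⟩
  have mem₁a : a ∈ S.image π₁ := Finset.mem_image.2 ⟨a, hA ha, by simp [hπ₁]⟩
  -- An exempt vertex inside `A` disappears in the contraction; the value `z` means that no vertex
  -- is exempt.
  have h₁ := h.map π₁ h.hσ (z' := z) (ex' := if ex ∈ A then z else ex) (mem₁ z h.hz hzA)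
    (by rw [fib₁ z h.hz hzA]; simpa using h.hpre) (by rw [fib₁ z h.hz hzA]; simpa using h.hdeg)
    (by
      rintro B hB hzB ⟨x, hx1, hx2, hx3⟩ hBex hBne
      refine ⟨?_, ?_, ?_⟩
      · simp [hπ₁, hzA, hzB]
      · obtain ⟨y, hy, rfl⟩ := Finset.mem_image.1 hx1
        refine ⟨y, hy, ?_, by simp [hx3]⟩
        rintro rfl
        exact hx2 (by simp [hπ₁, hzA])
      · intro hc
        have hmem : ∀ y ∈ S, π₁ y ∈ B → y = ex := fun y hy hyB => by
          have : y ∈ ({ex} : Finset V) := hc ▸ Finset.mem_filter.2 ⟨hy, hyB⟩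
          simpa using this
        have haB : a ∉ B := fun haB => hab <| by
          rw [hmem a (hA ha) (by simpa [hπ₁, ha] using haB),
            hmem b (hA hb) (by simpa [hπ₁, hb] using haB)]
        have hex : ex ∈ S ∧ π₁ ex ∈ B := by
          have : ex ∈ {x ∈ S | π₁ x ∈ B} := by rw [hc]; simp
          simpa using this
        have hexA : ex ∉ A := fun hexA => haB (by simpa [hπ₁, hexA] using hex.2)
        apply hBex
        rw [if_neg hexA]
        ext w
        simp only [Finset.mem_singleton]
        constructor
        · intro hw
          obtain ⟨y, hy, rfl⟩ := Finset.mem_image.1 (hB hw)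
          rw [hmem y hy hw]; simp [hπ₁, hexA]
        · rintro rfl
          simpa [hπ₁, hexA] using hex.2)
    (by
      split_ifs with hexA
      · simp
      · intro hexz
        obtain ⟨h1, h2⟩ := h.hex hexz
        exact ⟨mem₁ _ h1 hexA, by rw [fib₁ _ h1 hexA]; simpa using h2⟩)
  obtain ⟨σ₁, hσ₁, hpre₁, hnet₁⟩ := IH E _ _ _ _ _ _ _ _
    (card_image_lt_of_collision (hA ha) (hA hb) hab (by simp [hπ₁, hb])) h₁
  -- contract the complement of `A` to the vertex `z`
  obtain ⟨π₂, hπ₂⟩ : ∃ π : V → V, π = fun x => if x ∈ A then x else z := ⟨_, rfl⟩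
  have fib₂ : ∀ v ∈ A, {x ∈ S | π₂ x = v} = {v} := by
    intro v hv
    ext x
    simp only [hπ₂, Finset.mem_filter, Finset.mem_singleton]
    constructor
    · rintro ⟨_, h2⟩
      split_ifs at h2 with hxA
      · exact h2
      · exact absurd (h2 ▸ hv) hzA
    · rintro rfl
      simp [hv, hA hv]
  have fib₂z : {x ∈ S | π₂ x = z} = S \ A := by
    ext x
    simp only [hπ₂, Finset.mem_filter, Finset.mem_sdiff]
    refine and_congr_right fun _ => ?_
    split_ifs with hxA
    · simp only [hxA, not_true, iff_false]; rintro rfl; exact hzA hxA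
    · simp [hxA]
  have mem₂ : ∀ v ∈ A, v ∈ S.image π₂ := fun v hv =>
    Finset.mem_image.2 ⟨v, hA hv, by simp [hπ₂, hv]⟩
  have cutc : cutSize F s t (S \ A) = cutSize F s t A := by
    refine Finset.sum_congr rfl fun e he => ?_
    have h1 := h.hs e he
    have h2 := h.ht e he
    have : ∀ x ∈ S, ind (S \ A) x = 1 - ind A x := fun x hx => by
      by_cases hxA : x ∈ A <;> simp [ind, hx, hxA]
    rw [this _ h1, this _ h2, ← abs_neg]
    congr 1; ring
  have hβc : ∑ x ∈ S \ A, β x = ∑ x ∈ S, β x - ∑ x ∈ A, β x := by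
    rw [← Finset.sum_sdiff hA]; ring
  have hnetc : netOut F s t σ₁ (S \ A) = - netOut F s t σ₁ A := by
    have h1 := netOut_eq_zero h.hs h.ht σ₁
    rw [← sum_netOut_singleton, ← Finset.sum_sdiff hA, sum_netOut_singleton,
      sum_netOut_singleton] at h1
    linarith
  have hnetA : 2 * k ∣ netOut F s t σ₁ A - ∑ v ∈ A, β v := by
    have := (hnet₁ a mem₁a).1
    rw [netOut_comp π₁ h.hs h.ht] at this
    simpa [fib₁a] using this
  have hpre₂ : 2 * k ∣ netOut F s t σ₁ (S \ A) - ∑ x ∈ S \ A, β x := by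
    rw [hnetc, hβc, show - netOut F s t σ₁ A - (∑ x ∈ S, β x - ∑ x ∈ A, β x)
      = -(netOut F s t σ₁ A - ∑ x ∈ A, β x) - ∑ x ∈ S, β x by ring]
    exact dvd_sub (dvd_neg.2 hnetA) h.hsum
  have h₂ := h.map π₂ hσ₁ (z' := z) (ex' := if ex ∈ A then ex else z)
    (Finset.mem_image.2 ⟨z, h.hz, by simp [hπ₂]⟩)
    (by rw [fib₂z]; exact hpre₂)
    (by
      -- Here tightness is used: the cut of `A` becomes the degree of the new `z`, whose upper bound
      -- is the lower bound for `A`, since the boundaries of `A` and its complement are opposite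
      -- modulo `2k`.
      rw [fib₂z, cutc, htight, hβc]
      refine le_of_eq ?_
      congr 1
      rw [← circNorm_neg hk]
      refine circNorm_congr ?_
      rw [show -∑ v ∈ A, β v - (∑ x ∈ S, β x - ∑ x ∈ A, β x) = - ∑ x ∈ S, β x by ring]
      exact dvd_neg.2 h.hsum)
    (by
      rintro B hB hzB ⟨x, hx1, hx2, hx3⟩ hBex hBne
      have hBA : ∀ y ∈ S, π₂ y ∈ B → y ∈ A ∧ y ∈ B := fun y _ hyB => by
        simp only [hπ₂] at hyB
        split_ifs at hyB with hyA
        · exact ⟨hyA, hyB⟩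
        · exact absurd hyB hzB
      refine ⟨?_, ?_, ?_⟩
      · simp [hπ₂, hzA, hzB]
      · obtain ⟨y, hy, rfl⟩ := Finset.mem_image.1 hx1
        refine ⟨y, hy, ?_, by simp [hx3]⟩
        rintro rfl
        exact hx2 (by simp [hπ₂])
      · intro hc
        have hex : ex ∈ S ∧ π₂ ex ∈ B := by
          have : ex ∈ {x ∈ S | π₂ x ∈ B} := by rw [hc]; simp
          simpa using this
        obtain ⟨hexA, hexB⟩ := hBA ex hex.1 hex.2
        apply hBex
        rw [if_pos hexA]
        ext w
        simp only [Finset.mem_singleton]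
        constructor
        · intro hw
          obtain ⟨y, hy, rfl⟩ := Finset.mem_image.1 (hB hw)
          have hyA := (hBA y hy hw).1
          have : y ∈ ({ex} : Finset V) := hc ▸ Finset.mem_filter.2 ⟨hy, hw⟩
          simp only [Finset.mem_singleton] at this
          rw [this]; simp [hπ₂, hexA]
        · rintro rfl
          exact hexB)
    (by
      split_ifs with hexA
      · intro hexz
        obtain ⟨h1, h2⟩ := h.hex hexz
        exact ⟨mem₂ _ hexA, by rw [fib₂ _ hexA]; simpa using h2⟩
      · simp)
  obtain ⟨x, hxS, hxz, hxA⟩ := hx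
  obtain ⟨σ₂, hσ₂, hpre₂, hnet₂⟩ := IH E _ _ _ _ _ _ _ _
    (card_image_lt_of_collision h.hz hxS hxz.symm (by simp [hπ₂, hxA])) h₂
  -- Every edge with an end outside `A` is incident with `z` after the second contraction, so the
  -- two orientations glue.
  have key : ∀ e ∈ F, s e ∉ A ∨ t e ∉ A → σ₂ e = σ₁ e := fun e he hc => by
    refine hpre₂ e he (hc.imp ?_ ?_) <;> intro hc <;> simp [hπ₂, hc]
  refine ⟨σ₂, hσ₂, fun e he hc => ?_, fun v hv => ?_⟩
  · rw [key e he (hc.imp (fun hc : s e = z => hc ▸ hzA) fun hc : t e = z => hc ▸ hzA)]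
    refine hpre₁ e he (hc.imp ?_ ?_) <;> intro hc <;> simp [hπ₁, hc, hzA]
  · by_cases hvA : v ∈ A
    · have := hnet₂ v (mem₂ v hvA)
      rw [netOut_comp π₂ h.hs h.ht] at this
      simpa [fib₂ v hvA] using this
    · have := hnet₁ v (mem₁ v hv hvA)
      rw [netOut_comp π₁ h.hs h.ht] at this
      rw [netOut_congr (σ' := σ₁) fun e he hne =>
        key e he ((ends_of_ind_singleton_ne hne).imp (fun hc : s e = v => hc ▸ hvA)
          fun hc : t e = v => hc ▸ hvA)]
      simpa [fib₁ v hv hvA] using this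

/-- Cut size and boundary norm have the same parity, so a set that is not tight exceeds its bound by
at least two. -/
lemma Preoriented.slack_or_hasExtension (hk : 0 < k) (IH : ExtensionsBelow.{u, v} V k S.card)
    (h : Preoriented k S F s t σ β z ex) :
    HasExtension k S F s t σ β z ∨ ∀ A ⊆ S, (∃ a ∈ A, ∃ b ∈ A, a ≠ b) → z ∉ A →
      (∃ x ∈ S, x ≠ z ∧ x ∉ A) → 2 * k + circNorm k (∑ v ∈ A, β v) ≤ cutSize F s t A := by
  refine or_iff_not_imp_left.2 fun hno A hA ⟨a, ha, b, hb, hab⟩ hzA hx => ?_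
  have h1 := h.hcut A hA ⟨a, ha⟩ hzA hx (by
    rintro rfl
    simp only [Finset.mem_singleton] at ha hb
    exact hab (ha.trans hb.symm))
  have h2 := h.hpar A hA
  have h3 := two_dvd_circNorm_sub hk (∑ v ∈ A, β v)
  have h4 : cutSize F s t A ≠ 2 * k - 2 + circNorm k (∑ v ∈ A, β v) := fun hc =>
    hno (h.hasExtension_of_tight hk IH hA ha hb hab hzA hx hc)
  omega

/-- The given orientation already works: the net out-degree of a second vertex is the negative of
that of `z`. -/
lemma Preoriented.hasExtension_of_card_le_two (hk : 0 < k) (h : Preoriented k S F s t σ β z ex)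
    (hS : S.card ≤ 2) : HasExtension k S F s t σ β z := by
  refine ⟨σ, h.hσ, fun _ _ _ => rfl, fun v hv => ?_⟩
  by_cases hvz : v = z
  · subst hvz
    exact ⟨h.hpre, h.abs_netOut_lt hk⟩
  · have hS' : S = {v, z} := by
      symm
      refine Finset.eq_of_subset_of_card_le ?_ (by rw [Finset.card_pair hvz]; exact hS)
      simp [Finset.insert_subset_iff, hv, h.hz]
    have h1 := netOut_eq_zero h.hs h.ht σ
    rw [← sum_netOut_singleton, hS', Finset.sum_pair hvz] at h1
    have h2 := h.hsum
    rw [hS', Finset.sum_pair hvz] at h2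
    have h3 : netOut F s t σ {v} = - netOut F s t σ {z} := by linarith
    constructor
    · rw [h3, show - netOut F s t σ {z} - β v = -(netOut F s t σ {z} - β z) - (β v + β z) by ring]
      exact dvd_sub (dvd_neg.2 h.hpre) h2
    · rw [h3, abs_neg]
      exact h.abs_netOut_lt hk

/-! ### Lifting at a vertex of zero boundary. -/

lemma cutSize_singleton_eq_card (v : V) :
    cutSize F s t {v} = ({e ∈ F | ind {v} (s e) ≠ ind {v} (t e)}.card : ℤ) := by
  rw [Finset.card_filter, cutSize]
  push_cast
  refine Finset.sum_congr rfl fun e _ => ?_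
  rcases ind_cases {v} (s e) with h | h <;> rcases ind_cases {v} (t e) with h' | h' <;>
    simp [h, h']

/-- A vertex of zero boundary with at most one neighbour can be suppressed. -/
lemma Preoriented.hasExtension_of_one_neighbour (IH : ExtensionsBelow.{u, v} V k S.card)
    {v₀ u : V} (h : Preoriented k S F s t σ β z v₀) (hv₀ : v₀ ≠ z) (hu : u ∈ S) (huv : u ≠ v₀)
    (huz : u ≠ z) (hnb : ∀ e ∈ F, ind {v₀} (s e) ≠ ind {v₀} (t e) → s e = u ∨ t e = u) (hk : 0 < k) :
    HasExtension k S F s t σ β z := by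
  obtain ⟨hv₀S, hβ⟩ := h.hex hv₀
  obtain ⟨π, hπ⟩ : ∃ π : V → V, π = fun x => if x = v₀ then u else x := ⟨_, rfl⟩
  have fib : ∀ v ∈ S, v ≠ v₀ → v ≠ u → {x ∈ S | π x = v} = {v} := by
    intro v hv h1 h2
    ext x
    simp only [hπ, Finset.mem_filter, Finset.mem_singleton]
    constructor
    · rintro ⟨_, h3⟩
      split_ifs at h3 with hx
      · exact absurd h3.symm h2
      · exact h3
    · rintro rfl
      simp [hv, h1]
  have fibu : {x ∈ S | π x = u} = {u, v₀} := by
    ext x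
    simp only [hπ, Finset.mem_filter, Finset.mem_insert, Finset.mem_singleton]
    constructor
    · rintro ⟨_, h3⟩
      split_ifs at h3 with hx
      · exact Or.inr hx
      · exact Or.inl h3
    · rintro (rfl | rfl)
      · simp [hu]
      · simp [hv₀S]
  have mem : ∀ v ∈ S, v ≠ v₀ → v ∈ S.image π := fun v hv hv' =>
    Finset.mem_image.2 ⟨v, hv, by simp [hπ, hv']⟩
  have fibz := fib z h.hz hv₀.symm huz.symm
  have h₁ := h.map π h.hσ (z' := z) (ex' := z) (mem z h.hz hv₀.symm)
    (by rw [fibz]; simpa using h.hpre) (by rw [fibz]; simpa using h.hdeg)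
    (by
      rintro B hB hzB ⟨x, hx1, hx2, hx3⟩ - hBne
      refine ⟨by simp [hπ, hv₀.symm, hzB], ?_, fun hc => ?_⟩
      · obtain ⟨y, hy, rfl⟩ := Finset.mem_image.1 hx1
        refine ⟨y, hy, ?_, by simp [hx3]⟩
        rintro rfl
        exact hx2 (by simp [hπ, hv₀.symm])
      · have h1 : v₀ ∈ {x ∈ S | π x ∈ B} := by rw [hc]; simp
        have h2 : u ∈ {x ∈ S | π x ∈ B} := by
          simp only [hπ, Finset.mem_filter, if_true] at h1
          simp [hπ, hu, huv, h1.2]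
        rw [hc] at h2
        exact huv (Finset.mem_singleton.1 h2))
    (by simp)
  obtain ⟨σ₁, hσ₁, hpre₁, hnet₁⟩ := IH E _ _ _ _ _ _ _ _
    (card_image_lt_of_collision hu hv₀S huv (by simp [hπ])) h₁
  classical
  obtain ⟨N, hN⟩ : ∃ N, N = {e ∈ F | ind {v₀} (s e) ≠ ind {v₀} (t e)} := ⟨_, rfl⟩
  have hNeven : (2 : ℤ) ∣ N.card := by
    rw [hN, ← cutSize_singleton_eq_card]
    have h1 := h.hpar {v₀} (by simpa using hv₀S)
    rw [Finset.sum_singleton] at h1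
    have h2 : (2 : ℤ) ∣ β v₀ := (dvd_mul_right 2 k).trans hβ
    omega
  -- Half of the edges at `v₀` will leave it and half will enter it, so that `v₀` has net out-degree
  -- zero and merging it into `u` does not change the net out-degree of `u`.
  obtain ⟨T, hTN, hT⟩ := Finset.exists_subset_card_eq (s := N) (n := N.card / 2) (by omega)
  obtain ⟨σ', hσ'⟩ : ∃ σ' : E → ℤ, σ' = fun e => if e ∈ N then
    (ind {v₀} (s e) - ind {v₀} (t e)) * (if e ∈ T then 1 else -1) else σ₁ e := ⟨_, rfl⟩
  have memN : ∀ e, e ∈ N ↔ e ∈ F ∧ ind {v₀} (s e) ≠ ind {v₀} (t e) := by simp [hN]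
  have hout : ∀ e, e ∉ N → σ' e = σ₁ e := fun e he => by simp [hσ', he]
  have endsN : ∀ e ∈ N, (s e = u ∧ t e = v₀) ∨ (s e = v₀ ∧ t e = u) := fun e he => by
    obtain ⟨h1, h2⟩ := (memN e).1 he
    rcases ends_of_ind_singleton_ne h2 with h3 | h3 <;> rcases hnb e h1 h2 with h4 | h4
    · exact absurd (h4.symm.trans h3) huv
    · exact Or.inr ⟨h3, h4⟩
    · exact Or.inl ⟨h4, h3⟩
    · exact absurd (h4.symm.trans h3) huv
  have net0 : netOut F s t σ' {v₀} = 0 := by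
    have h1 : netOut F s t σ' {v₀} = ∑ e ∈ N, if e ∈ T then (1 : ℤ) else -1 := by
      rw [hN, Finset.sum_filter, netOut]
      refine Finset.sum_congr rfl fun e he => ?_
      by_cases hne : ind {v₀} (s e) ≠ ind {v₀} (t e)
      · rw [if_pos hne, hσ']
        simp only [(memN e).2 ⟨he, hne⟩, if_true]
        rcases ind_cases {v₀} (s e) with h | h <;> rcases ind_cases {v₀} (t e) with h' | h' <;>
          by_cases heT : e ∈ T <;> simp [h, h', heT] at hne ⊢
      · rw [if_neg hne, not_not.1 hne]; simp
    rw [h1, ← Finset.sum_sdiff hTN, Finset.sum_congr rfl (g := fun _ => (1 : ℤ)) (s₁ := T)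
      (by intro e he; simp [he]), Finset.sum_congr rfl (g := fun _ => (-1 : ℤ)) (s₁ := N \ T)
      (by intro e he; simp [(Finset.mem_sdiff.1 he).2])]
    have h2 := Finset.card_sdiff_add_card_eq_card hTN
    simp only [Finset.sum_const, nsmul_eq_mul, mul_neg, mul_one]
    omega
  refine ⟨σ', fun e => ?_, fun e he hez => ?_, fun v hv => ?_⟩
  · by_cases he : e ∈ N
    · have := ((memN e).1 he).2
      simp only [hσ', he, if_true]
      rcases ind_cases {v₀} (s e) with h | h <;> rcases ind_cases {v₀} (t e) with h' | h' <;>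
        split_ifs <;> simp [h, h'] at this ⊢
    · rw [hout e he]; exact hσ₁ e
  · rw [hout e fun heN => ?_]
    · refine hpre₁ e he (hez.imp ?_ ?_) <;> intro hc <;> simp [hπ, hc, hv₀.symm]
    · rcases endsN e heN with ⟨h1, h2⟩ | ⟨h1, h2⟩ <;> rw [h1, h2] at hez <;> tauto
  · by_cases hv1 : v = v₀
    · subst hv1
      rw [net0]
      exact ⟨by simpa using hβ, by simpa using hk⟩
    · have h2 := hnet₁ v (mem v hv hv1)
      rw [netOut_comp π h.hs h.ht] at h2
      by_cases hvu : v = u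
      · subst hvu
        simp only [Finset.mem_singleton, fibu] at h2
        rw [Finset.sum_pair huv] at h2
        have h3 : netOut F s t σ' {v} = netOut F s t σ₁ {v, v₀} := by
          rw [netOut_congr (σ := σ₁) (σ' := σ') fun e he hne => (hout e fun heN => hne ?_).symm,
            ← sum_netOut_singleton _ _ _ _ {v, v₀}, Finset.sum_pair huv, net0, add_zero]
          rcases endsN e heN with ⟨h1, h2⟩ | ⟨h1, h2⟩ <;> rw [h1, h2] <;> simp [ind]
        rw [h3]
        refine ⟨?_, h2.2⟩
        rw [show netOut F s t σ₁ {v, v₀} - β v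
          = netOut F s t σ₁ {v, v₀} - (β v + β v₀) + β v₀ by ring]
        exact dvd_add h2.1 hβ
      · simp only [Finset.mem_singleton, fib v hv hv1 hvu, Finset.sum_singleton] at h2
        rwa [netOut_congr (σ' := σ₁) fun e he hne => hout e fun heN => hne ?_]
        rcases endsN e heN with ⟨h1, h2⟩ | ⟨h1, h2⟩ <;> rw [h1, h2] <;>
          simp [ind, Ne.symm hv1, Ne.symm hvu]

section Lift

variable [DecidableEq E] {e f : E}

lemma sum_eq_add_add_sum_erase {M : Type*} [AddCommMonoid M] (he : e ∈ F) (hf : f ∈ F)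
    (hef : e ≠ f) (g : E → M) :
    ∑ x ∈ F, g x = g e + g f + ∑ x ∈ (F.erase f).erase e, g x := by
  rw [← Finset.add_sum_erase F g hf, ← Finset.add_sum_erase (F.erase f) g
    (Finset.mem_erase.2 ⟨hef, he⟩)]
  abel

lemma sum_erase_eq_add_sum_erase {M : Type*} [AddCommMonoid M] (he : e ∈ F)
    (hef : e ≠ f) (g : E → M) :
    ∑ x ∈ F.erase f, g x = g e + ∑ x ∈ (F.erase f).erase e, g x :=
  (Finset.add_sum_erase (F.erase f) g (Finset.mem_erase.2 ⟨hef, he⟩)).symm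

lemma cutSize_lift (he : e ∈ F) (hf : f ∈ F) (hef : e ≠ f) (u w : V) (A : Finset V) :
    cutSize F s t A = cutSize (F.erase f) (Function.update s e u) (Function.update t e w) A +
      (|ind A (s e) - ind A (t e)| + |ind A (s f) - ind A (t f)| - |ind A u - ind A w|) := by
  unfold cutSize
  rw [sum_eq_add_add_sum_erase he hf hef, sum_erase_eq_add_sum_erase he hef]
  have : ∀ x ∈ (F.erase f).erase e, |ind A (Function.update s e u x) -
      ind A (Function.update t e w x)| = |ind A (s x) - ind A (t x)| := fun x hx => by
    have := (Finset.mem_erase.1 hx).1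
    simp [Function.update_of_ne this]
  rw [Finset.sum_congr rfl this]
  simp only [Function.update_self]
  ring

lemma netOut_lift (he : e ∈ F) (hf : f ∈ F) (hef : e ≠ f) (u w : V) {σ τ : E → ℤ} (A : Finset V)
    (hστ : ∀ x, x ≠ e → x ≠ f → σ x = τ x) :
    netOut F s t σ A = netOut (F.erase f) (Function.update s e u) (Function.update t e w) τ A +
      (σ e * (ind A (s e) - ind A (t e)) + σ f * (ind A (s f) - ind A (t f))
        - τ e * (ind A u - ind A w)) := by
  unfold netOut
  rw [sum_eq_add_add_sum_erase he hf hef, sum_erase_eq_add_sum_erase he hef]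
  have : ∀ x ∈ (F.erase f).erase e, τ x * (ind A (Function.update s e u x) -
      ind A (Function.update t e w x)) = σ x * (ind A (s x) - ind A (t x)) := fun x hx => by
    have h1 := (Finset.mem_erase.1 hx).1
    have h2 := (Finset.mem_erase.1 (Finset.mem_erase.1 hx).2).1
    simp [Function.update_of_ne h1, hστ x h1 h2]
  rw [Finset.sum_congr rfl this]
  simp only [Function.update_self]
  ring

lemma exists_other_end {v x y : V} (h : ind {v} x ≠ ind {v} y) :
    ∃ u, u ≠ v ∧ ∃ ε : ℤ, (x = u ∧ y = v ∧ ε = 1 ∨ x = v ∧ y = u ∧ ε = -1) := by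
  by_cases hx : x = v
  · refine ⟨y, ?_, -1, Or.inr ⟨hx, rfl, rfl⟩⟩
    rintro rfl
    exact h (by rw [hx])
  · exact ⟨x, hx, 1, Or.inl ⟨rfl, (ends_of_ind_singleton_ne h).resolve_left hx, rfl⟩⟩

/-- Two edges at a vertex `v₀` with distinct other ends `u` and `w` can be replaced by an edge
joining `u` and `w`. -/
lemma Preoriented.hasExtension_of_lift {v₀ u w : V} {ε δ : ℤ}
    (h : Preoriented k S F s t σ β z v₀) (hv₀ : v₀ ≠ z)
    (hslack : ∀ A ⊆ S, (∃ a ∈ A, ∃ b ∈ A, a ≠ b) → z ∉ A →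
      (∃ x ∈ S, x ≠ z ∧ x ∉ A) → 2 * k + circNorm k (∑ v ∈ A, β v) ≤ cutSize F s t A)
    (he : e ∈ F) (hf : f ∈ F) (hef : e ≠ f) (huw : u ≠ w)
    (hε : s e = u ∧ t e = v₀ ∧ ε = 1 ∨ s e = v₀ ∧ t e = u ∧ ε = -1)
    (hδ : s f = w ∧ t f = v₀ ∧ δ = 1 ∨ s f = v₀ ∧ t f = w ∧ δ = -1)
    (IHF : ∀ (s t : E → V) (σ : E → ℤ), Preoriented k S (F.erase f) s t σ β z v₀ →
      HasExtension k S (F.erase f) s t σ β z) :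
    HasExtension k S F s t σ β z := by
  have hε1 : ε = 1 ∨ ε = -1 := by tauto
  have hδ1 : δ = 1 ∨ δ = -1 := by tauto
  have hεε : ε * ε = 1 := by rcases hε1 with h | h <;> rw [h] <;> norm_num
  have hδδ : δ * δ = 1 := by rcases hδ1 with h | h <;> rw [h] <;> norm_num
  have hiε : ∀ A, ind A (s e) - ind A (t e) = ε * (ind A u - ind A v₀) := fun A => by
    rcases hε with ⟨h1, h2, h3⟩ | ⟨h1, h2, h3⟩ <;> rw [h1, h2, h3] <;> ring
  have hiδ : ∀ A, ind A (s f) - ind A (t f) = δ * (ind A w - ind A v₀) := fun A => by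
    rcases hδ with ⟨h1, h2, h3⟩ | ⟨h1, h2, h3⟩ <;> rw [h1, h2, h3] <;> ring
  have hez : (s e = z ∨ t e = z) ↔ u = z := by
    rcases hε with ⟨h1, h2, h3⟩ | ⟨h1, h2, h3⟩ <;> simp [h1, h2, hv₀]
  have hfz : (s f = z ∨ t f = z) ↔ w = z := by
    rcases hδ with ⟨h1, h2, h3⟩ | ⟨h1, h2, h3⟩ <;> simp [h1, h2, hv₀]
  have huS : u ∈ S := by
    rcases hε with ⟨h1, h2, h3⟩ | ⟨h1, h2, h3⟩
    · exact h1 ▸ h.hs e he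
    · exact h2 ▸ h.ht e he
  have hwS : w ∈ S := by
    rcases hδ with ⟨h1, h2, h3⟩ | ⟨h1, h2, h3⟩
    · exact h1 ▸ h.hs f hf
    · exact h2 ▸ h.ht f hf
  obtain ⟨s', hs'⟩ : ∃ s', s' = Function.update s e u := ⟨_, rfl⟩
  obtain ⟨t', ht'⟩ : ∃ t', t' = Function.update t e w := ⟨_, rfl⟩
  have cut_eq : ∀ A, cutSize F s t A = cutSize (F.erase f) s' t' A +
      (|ind A u - ind A v₀| + |ind A w - ind A v₀| - |ind A u - ind A w|) := fun A => by
    rw [cutSize_lift he hf hef u w, hiε, hiδ, abs_mul, abs_mul, hs', ht']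
    rcases hε1 with h | h <;> rcases hδ1 with h' | h' <;> simp [h, h']
  -- These signs make `e` and `f` a directed path through `v₀`, running in the direction of the new
  -- edge between `u` and `w`.
  have net_eq : ∀ (τ τ' : E → ℤ), τ' e = ε * τ e → τ' f = -(δ * τ e) →
      (∀ x, x ≠ e → x ≠ f → τ' x = τ x) →
      ∀ A, netOut F s t τ' A = netOut (F.erase f) s' t' τ A := fun τ τ' h1 h2 h3 A => by
    rw [netOut_lift he hf hef u w A h3, hiε, hiδ, h1, h2, hs', ht']
    linear_combination τ e * (ind A u - ind A v₀) * hεε - τ e * (ind A w - ind A v₀) * hδδ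
  -- If `u` or `w` is `z`, the new edge inherits the orientation prescribed at `z`; there is no
  -- conflict since `u ≠ w`.
  obtain ⟨σ₀, hσ₀⟩ : ∃ σ₀, σ₀ = Function.update σ e
    (if u = z then ε * σ e else if w = z then -(δ * σ f) else σ e) := ⟨_, rfl⟩
  have hs₀ : ∀ x, σ₀ x = 1 ∨ σ₀ x = -1 := fun x => by
    by_cases hx : x = e
    · subst hx
      rw [hσ₀, Function.update_self]
      have := h.hσ x
      have := h.hσ f
      split_ifs
      · rcases hε1 with h | h <;> rw [h] <;> omega
      · rcases hδ1 with h | h <;> rw [h] <;> omega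
      · exact h.hσ x
    · rw [hσ₀, Function.update_of_ne hx]; exact h.hσ x
  have lift : ∀ τ : E → ℤ, ∃ τ' : E → ℤ, τ' e = ε * τ e ∧ τ' f = -(δ * τ e) ∧
      (∀ x, x ≠ e → x ≠ f → τ' x = τ x) := fun τ =>
    ⟨Function.update (Function.update τ e (ε * τ e)) f (-(δ * τ e)),
      by rw [Function.update_of_ne hef, Function.update_self], by rw [Function.update_self],
      fun x h1 h2 => by rw [Function.update_of_ne h2, Function.update_of_ne h1]⟩
  have agree : ∀ τ τ' : E → ℤ, τ' e = ε * τ e → τ' f = -(δ * τ e) →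
      (∀ x, x ≠ e → x ≠ f → τ' x = τ x) →
      (∀ x ∈ F.erase f, s' x = z ∨ t' x = z → τ x = σ₀ x) →
      ∀ x ∈ F, s x = z ∨ t x = z → τ' x = σ x := fun τ τ' h1 h2 h3 h4 x hx hxz => by
    have heF : e ∈ F.erase f := Finset.mem_erase.2 ⟨hef, he⟩
    by_cases hxe : x = e
    · subst hxe
      have huz := hez.1 hxz
      rw [h1, h4 x heF (Or.inl (by simp [hs', huz])), hσ₀, Function.update_self, if_pos huz,
        ← mul_assoc, hεε, one_mul]
    · by_cases hxf : x = f
      · subst hxf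
        have hwz := hfz.1 hxz
        have huz : u ≠ z := fun hc => huw (hc.trans hwz.symm)
        rw [h2, h4 e heF (Or.inr (by simp [ht', hwz])), hσ₀, Function.update_self, if_neg huz,
          if_pos hwz]
        linear_combination σ x * hδδ
      · rw [h3 x hxe hxf, h4 x (Finset.mem_erase.2 ⟨hxf, hx⟩), hσ₀, Function.update_of_ne hxe]
        rwa [hs', ht', Function.update_of_ne hxe, Function.update_of_ne hxe]
  have hnew : Preoriented k S (F.erase f) s' t' σ₀ β z v₀ :=
    { hz := h.hz
      hs := fun x hx => by
        by_cases hxe : x = e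
        · simpa [hs', hxe] using huS
        · rw [hs', Function.update_of_ne hxe]; exact h.hs x (Finset.mem_of_mem_erase hx)
      ht := fun x hx => by
        by_cases hxe : x = e
        · simpa [ht', hxe] using hwS
        · rw [ht', Function.update_of_ne hxe]; exact h.ht x (Finset.mem_of_mem_erase hx)
      hσ := hs₀
      hsum := h.hsum
      hpar := fun A hA => by
        have h1 := h.hpar A hA
        rw [cut_eq A] at h1
        rcases ind_cases A u with h2 | h2 <;> rcases ind_cases A w with h3 | h3 <;>
          rcases ind_cases A v₀ with h4 | h4 <;> simp [h2, h3, h4] at h1 <;> omega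
      hpre := by
        obtain ⟨τ', h1, h2, h3⟩ := lift σ₀
        rw [← net_eq σ₀ τ' h1 h2 h3, netOut_congr (σ' := σ) fun x hx hne =>
          agree σ₀ τ' h1 h2 h3 (fun _ _ _ => rfl) x hx (ends_of_ind_singleton_ne hne)]
        exact h.hpre
      hdeg := by
        have h1 := cut_eq {z}
        have h2 : 0 ≤ |ind {z} u - ind {z} v₀| + |ind {z} w - ind {z} v₀|
            - |ind {z} u - ind {z} w| := by
          rcases ind_cases {z} u with h2 | h2 <;> rcases ind_cases {z} w with h3 | h3 <;>
            rcases ind_cases {z} v₀ with h4 | h4 <;> simp [h2, h3, h4]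
        have := h.hdeg
        omega
      hcut := fun A hA hne hzA hx hAex => by
        have h1 := cut_eq A
        -- A cut loses two edges only if `v₀` lies on one side and both `u` and `w` on the other.
        -- Such a set has slack two, unless it is `{v₀}`, which is exempt.
        by_cases hA2 : ∃ a ∈ A, ∃ b ∈ A, a ≠ b
        · have h5 := hslack A hA hA2 hzA hx
          rcases ind_cases A u with h2 | h2 <;> rcases ind_cases A w with h3 | h3 <;>
            rcases ind_cases A v₀ with h4 | h4 <;> simp [h2, h3, h4] at h1 <;> omega
        · have h5 := h.hcut A hA hne hzA hx hAex
          obtain ⟨a, ha⟩ := hne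
          push Not at hA2
          have hv₀A : v₀ ∉ A := fun hc => hAex <| Finset.eq_singleton_iff_unique_mem.2
            ⟨hc, fun x hx => hA2 x hx v₀ hc⟩
          have huwA : ¬ (u ∈ A ∧ w ∈ A) := fun hc => huw (hA2 u hc.1 w hc.2)
          rw [ind_of_notMem hv₀A] at h1
          by_cases h2 : u ∈ A
          · have h3 : w ∉ A := fun hc => huwA ⟨h2, hc⟩
            simp [ind_of_mem h2, ind_of_notMem h3] at h1
            omega
          · by_cases h3 : w ∈ A <;> simp [ind, h2, h3] at h1 <;> omega
      hex := h.hex }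
  obtain ⟨τ, hτ, hτz, hτn⟩ := IHF s' t' σ₀ hnew
  obtain ⟨τ', h1, h2, h3⟩ := lift τ
  refine ⟨τ', fun x => ?_, agree τ τ' h1 h2 h3 hτz, fun v hv => ?_⟩
  · by_cases hxe : x = e
    · rw [hxe, h1]; rcases hε1 with h | h <;> rcases hτ e with h' | h' <;> simp [h, h']
    · by_cases hxf : x = f
      · rw [hxf, h2]; rcases hδ1 with h | h <;> rcases hτ e with h' | h' <;> simp [h, h']
      · rw [h3 x hxe hxf]; exact hτ x
  · rw [net_eq τ τ' h1 h2 h3]; exact hτn v hv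

end Lift

/-- By induction on the number of edges: pairs of edges at `v₀` with distinct other ends are lifted
until `v₀` has at most one neighbour, into which it is merged. -/
lemma Preoriented.hasExtension_of_exempt (hk : 0 < k) (IH : ExtensionsBelow.{u, v} V k S.card)
    {v₀ : V} (hv₀ : v₀ ≠ z) (h : Preoriented k S F s t σ β z v₀) :
    HasExtension k S F s t σ β z := by
  classical
  induction hn : F.card using Nat.strong_induction_on generalizing F s t σ with
  | _ n IHF =>
  subst hn
  rcases h.slack_or_hasExtension hk IH with h' | hslack
  · exact h'
  obtain ⟨hv₀S, hβ⟩ := h.hex hv₀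
  by_cases hS : ∃ x ∈ S, x ≠ z ∧ x ≠ v₀
  swap
  · push Not at hS
    refine h.hasExtension_of_card_le_two hk ?_
    refine (Finset.card_le_card (t := {z, v₀}) fun x hx => ?_).trans Finset.card_le_two
    have := hS x hx
    simp; tauto
  by_cases hall : ∃ e ∈ F, ∃ f ∈ F, ind {v₀} (s e) ≠ ind {v₀} (t e) ∧
      ind {v₀} (s f) ≠ ind {v₀} (t f) ∧ ¬ ∃ u, u ≠ v₀ ∧ (s e = u ∨ t e = u) ∧ (s f = u ∨ t f = u)
  · obtain ⟨e, he, f, hf, hse, hsf, hno⟩ := hall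
    obtain ⟨u, hu, ε, hε⟩ := exists_other_end hse
    obtain ⟨w, -, δ, hδ⟩ := exists_other_end hsf
    have huw : u ≠ w := by
      rintro rfl
      exact hno ⟨u, hu, by tauto, by tauto⟩
    refine h.hasExtension_of_lift hv₀ hslack he hf ?_ huw hε hδ
      fun s t σ h' => IHF _ (Finset.card_erase_lt_of_mem hf) h' rfl
    rintro rfl
    exact huw (by rcases hε with ⟨h1, h2, -⟩ | ⟨h1, h2, -⟩ <;>
      rcases hδ with ⟨h3, h4, -⟩ | ⟨h3, h4, -⟩ <;> simp_all)
  · push Not at hall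
    have one : ∃ u ∈ S, u ≠ v₀ ∧ u ≠ z ∧
        ∀ e ∈ F, ind {v₀} (s e) ≠ ind {v₀} (t e) → s e = u ∨ t e = u := by
      obtain ⟨x, hxS, hxz, hxv⟩ := hS
      by_cases hnb : ∃ e ∈ F, ind {v₀} (s e) ≠ ind {v₀} (t e)
      · obtain ⟨e, he, hne⟩ := hnb
        obtain ⟨u, hu, ε, hε⟩ := exists_other_end hne
        have hnbu : ∀ f ∈ F, ind {v₀} (s f) ≠ ind {v₀} (t f) → s f = u ∨ t f = u :=
          fun f hf hnf => by
            obtain ⟨u', hu', h1, h2⟩ := hall e he f hf hne hnf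
            have : u' = u := by
              rcases hε with ⟨h3, h4, -⟩ | ⟨h3, h4, -⟩ <;> rcases h1 with h1 | h1 <;> simp_all
            exact this ▸ h2
        have huS : u ∈ S := by
          rcases hε with ⟨h1, h2, h3⟩ | ⟨h1, h2, h3⟩
          · exact h1 ▸ h.hs e he
          · exact h2 ▸ h.ht e he
        refine ⟨u, huS, hu, ?_, hnbu⟩
        rintro rfl
        -- all edges at `v₀` lead to `z`, so that the rest of the graph has too small a boundary
        exfalso
        have h1 := h.hcut (S \ {v₀, u}) Finset.sdiff_subset ⟨x, by simp [hxS, hxz, hxv]⟩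
          (by simp) ⟨v₀, hv₀S, hv₀, by simp⟩ (by
            intro hc
            have : v₀ ∈ S \ {v₀, u} := by rw [hc]; simp
            simp at this)
        have h2 : ∑ v ∈ S \ {v₀, u}, β v = ∑ v ∈ S, β v - (β v₀ + β u) := by
          rw [← Finset.sum_pair hv₀, ← Finset.sum_sdiff (s₁ := {v₀, u}) (s₂ := S)
            (by simp [Finset.insert_subset_iff, hv₀S, h.hz])]
          ring
        have h3 : circNorm k (∑ v ∈ S \ {v₀, u}, β v) = circNorm k (β u) := by
          rw [← circNorm_neg hk (β u)]
          refine circNorm_congr ?_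
          rw [h2, show ∑ v ∈ S, β v - (β v₀ + β u) - -β u = ∑ v ∈ S, β v - β v₀ by ring]
          exact dvd_sub h.hsum hβ
        have h4 : cutSize F s t {u} = cutSize F s t {v₀} + cutSize F s t (S \ {v₀, u}) := by
          unfold cutSize
          rw [← Finset.sum_add_distrib]
          refine Finset.sum_congr rfl fun f hf => ?_
          have hi : ∀ y ∈ S, ind (S \ {v₀, u}) y = 1 - ind {v₀} y - ind {u} y := fun y hy => by
            by_cases hy1 : y = v₀
            · subst hy1; simp [ind, hv₀]
            · by_cases hy2 : y = u
              · subst hy2; simp [ind, hy1]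
              · simp [ind, hy1, hy2, hy]
          rw [hi _ (h.hs f hf), hi _ (h.ht f hf)]
          by_cases hnf : ind {v₀} (s f) = ind {v₀} (t f)
          · rw [hnf, sub_self, abs_zero, zero_add, ← abs_neg]
            congr 1; ring
          · have h5 := hnbu f hf hnf
            rcases ends_of_ind_singleton_ne hnf with h6 | h6
            · have h7 : t f = u := h5.resolve_left fun hc => hv₀ (h6.symm.trans hc)
              rw [h6, h7]; simp [ind, hv₀, hv₀.symm]
            · have h7 : s f = u := h5.resolve_right fun hc => hv₀ (h6.symm.trans hc)
              rw [h6, h7]; simp [ind, hv₀, hv₀.symm]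
        have h5 : 0 < cutSize F s t {v₀} := by
          rw [cutSize_singleton_eq_card]
          exact_mod_cast Finset.card_pos.2 ⟨e, by simp [he, hne]⟩
        have := h.hdeg
        omega
      · push Not at hnb
        exact ⟨x, hxS, hxv, hxz, fun e he hne => absurd (hnb e he) hne⟩
    obtain ⟨u, huS, hu, huz, hnb⟩ := one
    exact h.hasExtension_of_one_neighbour IH hv₀ huS hu huz hnb hk

/-- Only sets avoiding `z` are constrained, so exempting `z` exempts nothing. The exemption can thus
be given to any vertex of zero boundary, whose degree may then drop under lifting. -/
lemma Preoriented.with_exempt (h : Preoriented k S F s t σ β z z) {v₀ : V} (hv₀ : v₀ ∈ S)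
    (hβ : 2 * k ∣ β v₀) : Preoriented k S F s t σ β z v₀ :=
  { h with
    hcut := fun A hA hne hzA hx _ => h.hcut A hA hne hzA hx (by rintro rfl; simp at hzA)
    hex := fun _ => ⟨hv₀, hβ⟩ }

/-! ### Deleting an edge and adjusting the boundary. -/

/-- `x` is congruent to one of `1, …, k` modulo `2 * k`. -/
def IsPosMod (k x : ℤ) : Prop := ∃ b, 1 ≤ b ∧ b ≤ k ∧ 2 * k ∣ x - b

lemma isPosMod_trichotomy {k : ℤ} (hk : 0 < k) (x : ℤ) :
    2 * k ∣ x ∨ IsPosMod k x ∨ IsPosMod k (-x) := by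
  obtain ⟨j, hj⟩ := exists_circNorm_eq k x hk
  have h1 := circNorm_nonneg hk x
  have h2 := circNorm_le (k := k) x
  rcases h1.eq_or_lt with h0 | h0
  · exact Or.inl ((circNorm_eq_zero_iff hk).1 h0.symm)
  · right
    rcases abs_choice (x - 2 * k * j) with h | h
    · exact Or.inl ⟨circNorm k x, by omega, h2, ⟨j, by rw [hj, h]; ring⟩⟩
    · exact Or.inr ⟨circNorm k x, by omega, h2, ⟨-j, by rw [hj, h]; ring⟩⟩

lemma circNorm_eq_of_dvd_sub {k x b : ℤ} (h0 : 0 ≤ b) (hb : b ≤ k) (h : 2 * k ∣ x - b) :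
    circNorm k x = b := by
  rw [circNorm_congr h, circNorm_of_nonneg h0 hb]

lemma circNorm_sub_one {k x : ℤ} (h : IsPosMod k x) : circNorm k (x - 1) + 1 = circNorm k x := by
  obtain ⟨b, h1, h2, h3⟩ := h
  rw [circNorm_eq_of_dvd_sub (by omega) h2 h3, circNorm_eq_of_dvd_sub (b := b - 1) (by omega)
    (by omega) (h3.trans (dvd_of_eq (by ring)))]
  ring

/-- The sum could only fail by being equal to `2k`, which would make `x` a multiple of `2k`. This
restores a deleted edge without violating the bound. -/
lemma abs_add_one_lt {k x N : ℤ} (h : IsPosMod k x) (hN : |N| < 2 * k)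
    (hx : 2 * k ∣ N - (x - 1)) : |N + 1| < 2 * k := by
  obtain ⟨b, h1, h2, h3⟩ := h
  rw [abs_lt] at hN ⊢
  refine ⟨by omega, lt_of_le_of_ne (by omega) fun hc => ?_⟩
  have h4 : 2 * k ∣ b := by
    have h5 : 2 * k ∣ N + 1 - b := by
      exact (dvd_add hx h3).trans (dvd_of_eq (by ring))
    rw [hc] at h5
    exact (dvd_sub_right (dvd_refl _)).1 h5
  have := Int.le_of_dvd (by omega) h4
  omega

lemma sum_shift (β : V → ℤ) (x y : V) (c : ℤ) (A : Finset V) :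
    ∑ v ∈ A, (β v + c * (ind {v} x - ind {v} y)) =
      ∑ v ∈ A, β v + c * (ind A x - ind A y) := by
  rw [Finset.sum_add_distrib, ← Finset.mul_sum, Finset.sum_sub_distrib, sum_ind_singleton,
    sum_ind_singleton]

lemma cutSize_eq_add_erase [DecidableEq E] {e : E} (he : e ∈ F) {x y : V} {ε : ℤ}
    (hε : s e = x ∧ t e = y ∧ ε = 1 ∨ s e = y ∧ t e = x ∧ ε = -1) (A : Finset V) :
    cutSize F s t A = |ind A x - ind A y| + cutSize (F.erase e) s t A := by
  have : |ind A x - ind A y| = |ind A (s e) - ind A (t e)| := by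
    rcases hε with ⟨h1, h2, -⟩ | ⟨h1, h2, -⟩ <;> rw [h1, h2]
    exact abs_sub_comm _ _
  rw [this]
  exact (Finset.add_sum_erase _ _ he).symm

lemma netOut_eq_add_erase [DecidableEq E] {e : E} (he : e ∈ F) {x y : V} {ε : ℤ}
    (hε : s e = x ∧ t e = y ∧ ε = 1 ∨ s e = y ∧ t e = x ∧ ε = -1) {τ τ' : E → ℤ} (h1 : τ' e = ε)
    (h2 : ∀ f, f ≠ e → τ' f = τ f) (A : Finset V) :
    netOut F s t τ' A = (ind A x - ind A y) + netOut (F.erase e) s t τ A := by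
  have hi : ε * (ind A (s e) - ind A (t e)) = ind A x - ind A y := by
    rcases hε with ⟨h1, h2, h3⟩ | ⟨h1, h2, h3⟩ <;> rw [h1, h2, h3] <;> ring
  unfold netOut
  rw [← Finset.add_sum_erase _ _ he, h1, hi]
  congr 1
  exact Finset.sum_congr rfl fun f hf => by rw [h2 f (Finset.mem_erase.1 hf).1]

lemma circNorm_shift_add_le {a x y : V} {b : ℤ} (hxy : x ≠ y) (hx : x = a → IsPosMod k b)
    (hy : y = a → IsPosMod k (-b)) (hk : 0 < k) :
    circNorm k (b + (-1) * (ind {a} x - ind {a} y)) + |ind {a} x - ind {a} y| ≤ circNorm k b := by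
  simp only [ind_singleton]
  by_cases hxa : x = a
  · have h6 := circNorm_sub_one (hx hxa)
    have hya : y ≠ a := fun hc => hxy (hxa.trans hc.symm)
    rw [if_pos hxa, if_neg hya]
    exact le_of_eq h6
  · rw [if_neg hxa]
    by_cases hya : y = a
    · have h6 := circNorm_sub_one (hy hya)
      rw [← circNorm_neg hk, circNorm_neg hk b] at h6
      rw [if_pos hya, show b + -1 * (0 - 1) = -(-b - 1) by ring]
      exact le_of_eq h6
    · simp [hya]

/-- Deleting an edge that is oriented from `x` to `y`. -/
lemma Preoriented.erase [DecidableEq E] (hk : 0 < k) (h : Preoriented k S F s t σ β z z)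
    (hslack : ∀ A ⊆ S, (∃ a ∈ A, ∃ b ∈ A, a ≠ b) → z ∉ A →
      (∃ x ∈ S, x ≠ z ∧ x ∉ A) → 2 * k + circNorm k (∑ v ∈ A, β v) ≤ cutSize F s t A)
    {e : E} (he : e ∈ F) {x y : V} {ε : ℤ} (hxy : x ≠ y)
    (hε : s e = x ∧ t e = y ∧ ε = 1 ∨ s e = y ∧ t e = x ∧ ε = -1)
    (hx : x ≠ z → IsPosMod k (β x)) (hy : y ≠ z → IsPosMod k (-β y))
    (hz : x = z ∨ y = z → ε = σ e) :
    Preoriented k S (F.erase e) s t σ (fun v => β v + (-1) * (ind {v} x - ind {v} y)) z z where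
  hz := h.hz
  hs := fun f hf => h.hs f (Finset.mem_of_mem_erase hf)
  ht := fun f hf => h.ht f (Finset.mem_of_mem_erase hf)
  hσ := h.hσ
  hsum := by
    have hxS : x ∈ S ∧ y ∈ S := by
      rcases hε with ⟨h1, h2, -⟩ | ⟨h1, h2, -⟩
      · exact ⟨h1 ▸ h.hs e he, h2 ▸ h.ht e he⟩
      · exact ⟨h2 ▸ h.ht e he, h1 ▸ h.hs e he⟩
    rw [sum_shift, ind_of_mem hxS.1, ind_of_mem hxS.2]
    simpa using h.hsum
  hpar := fun A hA => by
    rw [sum_shift]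
    have h1 := h.hpar A hA
    rw [cutSize_eq_add_erase he hε A] at h1
    rcases ind_cases A x with h2 | h2 <;> rcases ind_cases A y with h3 | h3 <;>
      simp [h2, h3] at h1 ⊢ <;> omega
  hpre := by
    have hez : (s e = z ∨ t e = z) ↔ (x = z ∨ y = z) := by
      rcases hε with ⟨h1, h2, -⟩ | ⟨h1, h2, -⟩ <;> rw [h1, h2]
      exact or_comm
    have h1 : netOut F s t σ {z} =
        (ind {z} x - ind {z} y) + netOut (F.erase e) s t σ {z} := by
      by_cases hez' : x = z ∨ y = z
      · exact netOut_eq_add_erase he hε (hz hez').symm (fun _ _ => rfl) {z}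
      · push Not at hez'
        rw [netOut_congr (σ' := Function.update σ e ε), netOut_eq_add_erase he hε (τ := σ)
          (τ' := Function.update σ e ε)]
        · simp
        · intro f hf; simp [hf]
        · intro f hf hne
          have : f ≠ e := by
            rintro rfl
            have := hez.1 (ends_of_ind_singleton_ne hne)
            tauto
          simp [this]
    have h2 := h.hpre
    rw [h1] at h2
    exact h2.trans (dvd_of_eq (by ring))
  hdeg := by
    have h1 := cutSize_eq_add_erase he hε {z}
    have h2 := h.hdeg
    have h3 := circNorm_add_le hk (β z + (-1) * (ind {z} x - ind {z} y))
      (ind {z} x - ind {z} y)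
    rw [show β z + (-1) * (ind {z} x - ind {z} y) + (ind {z} x - ind {z} y) = β z by ring]
      at h3
    omega
  hcut := fun A hA hne hzA hxA hAex => by
    rw [sum_shift]
    have h1 := cutSize_eq_add_erase he hε A
    -- For larger sets the cut drops and the norm grows by at most one each, within the slack of
    -- two. For a single vertex the lost edge is paid for by a smaller norm.
    by_cases hA2 : ∃ a ∈ A, ∃ b ∈ A, a ≠ b
    · have h2 := hslack A hA hA2 hzA hxA
      have h3 := circNorm_add_le hk (∑ v ∈ A, β v) ((-1) * (ind A x - ind A y))
      have h4 := abs_ind_sub_le A x y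
      rw [abs_mul, abs_neg, abs_one, one_mul] at h3
      omega
    · have h5 := h.hcut A hA hne hzA hxA hAex
      obtain ⟨a, ha⟩ := hne
      push Not at hA2
      have hAa : A = {a} := Finset.eq_singleton_iff_unique_mem.2
        ⟨ha, fun x hx => hA2 x hx a ha⟩
      subst hAa
      have haz : a ≠ z := fun hc => hzA (by simp [hc])
      have h6 := circNorm_shift_add_le (a := a) (b := β a) hxy (by rintro rfl; exact hx haz)
        (by rintro rfl; exact hy haz) hk
      rw [Finset.sum_singleton] at h5 ⊢
      omega
  hex := fun hc => absurd rfl hc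

/-- An edge can be deleted if orienting it from `x` to `y` decreases the norms of the boundaries of
those of its ends that are different from `z`. -/
lemma Preoriented.hasExtension_of_erase [DecidableEq E] (hk : 0 < k)
    (h : Preoriented k S F s t σ β z z)
    (hslack : ∀ A ⊆ S, (∃ a ∈ A, ∃ b ∈ A, a ≠ b) → z ∉ A →
      (∃ x ∈ S, x ≠ z ∧ x ∉ A) → 2 * k + circNorm k (∑ v ∈ A, β v) ≤ cutSize F s t A)
    {e : E} (he : e ∈ F) {x y : V} {ε : ℤ} (hxy : x ≠ y)
    (hε : s e = x ∧ t e = y ∧ ε = 1 ∨ s e = y ∧ t e = x ∧ ε = -1)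
    (hx : x ≠ z → IsPosMod k (β x)) (hy : y ≠ z → IsPosMod k (-β y))
    (hz : x = z ∨ y = z → ε = σ e)
    (IHF : Preoriented k S (F.erase e) s t σ (fun v => β v + (-1) * (ind {v} x - ind {v} y)) z z →
      HasExtension k S (F.erase e) s t σ (fun v => β v + (-1) * (ind {v} x - ind {v} y)) z) :
    HasExtension k S F s t σ β z := by
  have hε1 : ε = 1 ∨ ε = -1 := by tauto
  have hez : (s e = z ∨ t e = z) ↔ (x = z ∨ y = z) := by
    rcases hε with ⟨h1, h2, -⟩ | ⟨h1, h2, -⟩ <;> rw [h1, h2]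
    exact or_comm
  obtain ⟨τ, hτ, hτz, hτn⟩ := IHF (h.erase hk hslack he hxy hε hx hy hz)
  have agree : ∀ f ∈ F, s f = z ∨ t f = z → Function.update τ e ε f = σ f := fun f hf hfz => by
    by_cases hfe : f = e
    · subst hfe
      rw [Function.update_self]
      exact hz (hez.1 hfz)
    · rw [Function.update_of_ne hfe]
      exact hτz f (Finset.mem_erase.2 ⟨hfe, hf⟩) hfz
  refine ⟨Function.update τ e ε, fun f => ?_, agree, fun v hv => ?_⟩
  · by_cases hfe : f = e
    · subst hfe; rwa [Function.update_self]
    · rw [Function.update_of_ne hfe]; exact hτ f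
  · obtain ⟨h1, h2⟩ := hτn v hv
    have h3 := netOut_eq_add_erase he hε (τ := τ) (τ' := Function.update τ e ε) (by simp)
      (fun f hf => by simp [hf]) {v}
    constructor
    · rw [h3]
      exact h1.trans (dvd_of_eq (by ring))
    · by_cases hvz : v = z
      · subst hvz
        rw [netOut_congr (σ' := σ) fun f hf hne => agree f hf (ends_of_ind_singleton_ne hne)]
        exact h.abs_netOut_lt hk
      · rw [h3]
        by_cases hxv : x = v
        · subst hxv
          simp only [ind_singleton, if_true, hxy.symm, if_false] at h1 ⊢
          rw [add_comm, sub_zero]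
          exact abs_add_one_lt (hx hvz) h2 (h1.trans (dvd_of_eq (by ring)))
        · by_cases hyv : y = v
          · subst hyv
            simp only [ind_singleton, if_true, hxy, if_false] at h1 ⊢
            rw [← abs_neg] at h2 ⊢
            have := abs_add_one_lt (hy hvz) h2 (by
              rw [← dvd_neg]
              exact h1.trans (dvd_of_eq (by ring)))
            convert this using 2
            ring
          · simp only [ind_singleton, hxv, hyv, if_false]
            simpa using h2

/-! ### Positive and negative boundaries: the main induction. -/

lemma cutSize_eq_add_of_separated {P Q Z : Finset V}
    (hs : ∀ e ∈ F, (s e ∈ P ↔ s e ∉ Q ∧ s e ∉ Z) ∧ (s e ∈ Q → s e ∉ Z))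
    (ht : ∀ e ∈ F, (t e ∈ P ↔ t e ∉ Q ∧ t e ∉ Z) ∧ (t e ∈ Q → t e ∉ Z))
    (hsep : ∀ e ∈ F, ¬ (s e ∈ P ∧ t e ∈ Q) ∧ ¬ (s e ∈ Q ∧ t e ∈ P)) :
    cutSize F s t Z = cutSize F s t P + cutSize F s t Q := by
  unfold cutSize
  rw [← Finset.sum_add_distrib]
  refine Finset.sum_congr rfl fun e he => ?_
  have h1 := hs e he
  have h2 := ht e he
  have h3 := hsep e he
  unfold ind
  by_cases a1 : s e ∈ Q <;> by_cases a2 : s e ∈ Z <;> by_cases b1 : t e ∈ Q <;>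
    by_cases b2 : t e ∈ Z <;> simp only [a1, a2, b1, b2] at h1 h2 h3 ⊢ <;> simp at h1 h2 h3 ⊢ <;>
    simp [h1, h2] at h3 ⊢

/-- As long as no boundary outside `z` vanishes, some edge joins a positive vertex to a negative
one; directed that way, it can be deleted. The process ends with a vertex of zero boundary, which is
why zero is admitted at `x` and `y`. -/
lemma Preoriented.hasExtension_of_mixed (hk : 3 ≤ k) (IH : ExtensionsBelow.{u, v} V k S.card)
    (h : Preoriented k S F s t σ β z z) {x y : V} (hx : x ∈ S) (hy : y ∈ S) (hxz : x ≠ z)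
    (hyz : y ≠ z) (hxy : x ≠ y) (hβx : 2 * k ∣ β x ∨ IsPosMod k (β x))
    (hβy : 2 * k ∣ β y ∨ IsPosMod k (-β y)) : HasExtension k S F s t σ β z := by
  classical
  have hk0 : 0 < k := by omega
  induction hn : F.card using Nat.strong_induction_on generalizing F β x y with
  | _ n IHF =>
  subst hn
  by_cases hzero : ∃ v ∈ S, v ≠ z ∧ 2 * k ∣ β v
  · obtain ⟨v, hv, hvz, hβv⟩ := hzero
    exact (h.with_exempt hv hβv).hasExtension_of_exempt hk0 IH hvz
  push Not at hzero
  rcases h.slack_or_hasExtension hk0 IH with h' | hslack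
  · exact h'
  replace hβx := hβx.resolve_left (hzero x hx hxz)
  replace hβy := hβy.resolve_left (hzero y hy hyz)
  -- The residue `k` is both positive and negative, so `y` has to be kept out of `P` explicitly.
  obtain ⟨P, hP⟩ : ∃ P, P = {v ∈ S | v ≠ z ∧ v ≠ y ∧ IsPosMod k (β v)} := ⟨_, rfl⟩
  obtain ⟨Q, hQ⟩ : ∃ Q, Q = {v ∈ S | v ≠ z ∧ v ∉ P} := ⟨_, rfl⟩
  have hP1 : ∀ v ∈ P, v ∈ S ∧ v ≠ z ∧ IsPosMod k (β v) := fun v hv => by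
    simp only [hP, Finset.mem_filter] at hv; tauto
  have hQ1 : ∀ v ∈ Q, v ∈ S ∧ v ≠ z ∧ v ∉ P ∧ IsPosMod k (-β v) := fun v hv => by
    simp only [hQ, Finset.mem_filter] at hv
    refine ⟨hv.1, hv.2.1, hv.2.2, ?_⟩
    by_cases hvy : v = y
    · rwa [hvy]
    · rcases isPosMod_trichotomy hk0 (β v) with h1 | h1 | h1
      · exact absurd h1 (hzero v hv.1 hv.2.1)
      · exact absurd (by simp [hP, hv.1, hv.2.1, hvy, h1]) hv.2.2
      · exact h1
  have hxP : x ∈ P := by simp [hP, hx, hxz, hxy, hβx]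
  have hyP : y ∉ P := by simp [hP]
  have hyQ : y ∈ Q := by simp [hQ, hy, hyz, hyP]
  have hedge : ∃ e ∈ F, ∃ x' ∈ P, ∃ y' ∈ Q, ∃ ε : ℤ,
      (s e = x' ∧ t e = y' ∧ ε = 1 ∨ s e = y' ∧ t e = x' ∧ ε = -1) := by
    by_contra hno
    have hno' : ∀ e ∈ F, ¬ (s e ∈ P ∧ t e ∈ Q) ∧ ¬ (s e ∈ Q ∧ t e ∈ P) := fun e he =>
      ⟨fun hc => hno ⟨e, he, s e, hc.1, t e, hc.2, 1, by simp⟩,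
        fun hc => hno ⟨e, he, t e, hc.2, s e, hc.1, -1, by simp⟩⟩
    have h1 := h.hcut P (fun v hv => (hP1 v hv).1) ⟨x, hxP⟩ (fun hc => (hP1 _ hc).2.1 rfl)
      ⟨y, hy, hyz, hyP⟩ (by rintro rfl; exact (hP1 z (by simp)).2.1 rfl)
    have h2 := h.hcut Q (fun v hv => (hQ1 v hv).1) ⟨y, hyQ⟩ (fun hc => (hQ1 _ hc).2.1 rfl)
      ⟨x, hx, hxz, fun hc => (hQ1 x hc).2.2.1 hxP⟩
      (by rintro rfl; exact (hQ1 z (by simp)).2.1 rfl)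
    have h3 : cutSize F s t {z} = cutSize F s t P + cutSize F s t Q := by
      have hmem : ∀ v ∈ S, (v ∈ P ↔ v ∉ Q ∧ v ∉ ({z} : Finset V)) ∧ (v ∈ Q → v ∉ ({z} : Finset V)) :=
        fun v hv => by
          have h1 := hP1 v
          have h3 : v ∈ Q ↔ v ∈ S ∧ v ≠ z ∧ v ∉ P := by simp [hQ]
          rw [Finset.mem_singleton]
          tauto
      exact cutSize_eq_add_of_separated (fun e he => hmem _ (h.hs e he))
        (fun e he => hmem _ (h.ht e he)) hno'
    -- Without an edge between `P` and `Q`, the degree of `z` would be at least `2(2k - 2)`, but it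
    -- is at most `3k - 2`; this needs `k ≥ 3`.
    have h4 := circNorm_nonneg hk0 (∑ v ∈ P, β v)
    have h5 := circNorm_nonneg hk0 (∑ v ∈ Q, β v)
    have h6 := circNorm_le (k := k) (β z)
    have := h.hdeg
    omega
  obtain ⟨e, he, x', hx', y', hy', ε, hε⟩ := hedge
  obtain ⟨hx1, hx2, b, hb1, hb2, hb3⟩ := hP1 x' hx'
  obtain ⟨hy1, hy2, hyP', c, hc1, hc2, hc3⟩ := hQ1 y' hy'
  have hxy' : x' ≠ y' := fun hc => hyP' (hc ▸ hx')
  refine h.hasExtension_of_erase hk0 hslack he hxy' hε (fun _ => ⟨b, hb1, hb2, hb3⟩)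
    (fun _ => ⟨c, hc1, hc2, hc3⟩) (by tauto)
    fun h' => IHF _ (Finset.card_erase_lt_of_mem he) h' hx1 hy1 hx2 hy2 hxy' ?_ ?_ rfl
  · simp only [ind_singleton, if_true, hxy'.symm, if_false]
    rcases hb1.eq_or_lt with hb | hb
    · left; subst hb; exact hb3.trans (dvd_of_eq (by ring))
    · right; exact ⟨b - 1, by omega, by omega, hb3.trans (dvd_of_eq (by ring))⟩
  · simp only [ind_singleton, if_true, hxy', if_false]
    rcases hc1.eq_or_lt with hb | hb
    · left; subst hb; rw [← dvd_neg]; exact hc3.trans (dvd_of_eq (by ring))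
    · right; exact ⟨c - 1, by omega, by omega, hc3.trans (dvd_of_eq (by ring))⟩

/-- This is the degree bound at `z` after adding `r` incoming edges when its `D` present edges all
leave it. -/
lemma circNorm_flip {k D r b : ℤ} (hk : 0 < k) (hr0 : 0 ≤ r) (hr : r ≤ k - 1) (hD0 : 0 ≤ D)
    (hD : D < 2 * k) (hb : 2 * k ∣ D - b) : D + r ≤ 2 * k - 2 + circNorm k (b - r) := by
  have h1 : circNorm k (b - r) = circNorm k (D - r) :=
    circNorm_congr ((dvd_neg.2 hb).trans (dvd_of_eq (by ring)))
  rw [h1]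
  by_cases h2 : D - r < 0
  · rw [← circNorm_neg hk, circNorm_of_nonneg (by omega) (by omega)]; omega
  · by_cases h3 : D - r ≤ k
    · rw [circNorm_of_nonneg (by omega) h3]; omega
    · rw [← circNorm_neg hk, circNorm_eq_of_dvd_sub (b := 2 * k - (D - r)) (by omega) (by omega)
        ⟨-1, by ring⟩]
      omega

lemma cutSize_disjSum (F : Finset E) (s t : E → V) (r : ℕ) (y z : V) (A : Finset V) :
    cutSize (F.disjSum (Finset.univ : Finset (Fin r))) (Sum.elim s fun _ => y)
      (Sum.elim t fun _ => z) A = cutSize F s t A + r * |ind A y - ind A z| := by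
  simp [cutSize, Finset.sum_disjSum]

lemma netOut_disjSum (F : Finset E) (s t : E → V) (r : ℕ) (y z : V) (τ : E ⊕ Fin r → ℤ)
    (hτ : ∀ i, τ (Sum.inr i) = 1) (A : Finset V) :
    netOut (F.disjSum (Finset.univ : Finset (Fin r))) (Sum.elim s fun _ => y)
      (Sum.elim t fun _ => z) τ A = netOut F s t (τ ∘ Sum.inl) A + r * (ind A y - ind A z) := by
  simp [netOut, Finset.sum_disjSum, hτ]
  ring

/-- Adding `r` edges oriented from `y` to `z`. -/
lemma Preoriented.add_edges (hk : 0 < k) (h : Preoriented k S F s t σ β z z) {y : V} (hy : y ∈ S)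
    (hyz : y ≠ z) (r : ℕ) (hr : (r : ℤ) ≤ k - 1) (hout : netOut F s t σ {z} = cutSize F s t {z}) :
    Preoriented k S (F.disjSum (Finset.univ : Finset (Fin r))) (Sum.elim s fun _ => y)
      (Sum.elim t fun _ => z) (Sum.elim σ fun _ => 1)
      (fun v => β v + r * (ind {v} y - ind {v} z)) z z where
  hz := h.hz
  hs := by
    rintro (e | i) he
    · exact h.hs e (by simpa using he)
    · exact hy
  ht := by
    rintro (e | i) he
    · exact h.ht e (by simpa using he)
    · exact h.hz
  hσ := by
    rintro (e | i)
    · exact h.hσ e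
    · exact Or.inl rfl
  hsum := by
    rw [sum_shift, ind_of_mem hy, ind_of_mem h.hz]
    simpa using h.hsum
  hpar A hA := by
    rw [sum_shift, cutSize_disjSum]
    have h1 := h.hpar A hA
    rcases ind_cases A y with h2 | h2 <;> rcases ind_cases A z with h3 | h3 <;>
      simp [h2, h3] <;> omega
  hpre := by
    rw [netOut_disjSum _ _ _ _ _ _ _ (fun _ => rfl), Sum.elim_comp_inl]
    exact h.hpre.trans (dvd_of_eq (by ring))
  hdeg := by
    rw [cutSize_disjSum]
    have h1 := h.hpre
    rw [hout] at h1
    have h2 := h.abs_netOut_lt hk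
    have h3 := cutSize_nonneg F s t {z}
    rw [hout, abs_of_nonneg h3] at h2
    have h4 := circNorm_flip hk (Int.natCast_nonneg r) hr h3 h2 h1
    simpa [ind_singleton, hyz, ← sub_eq_add_neg] using h4
  hcut A hA hne hzA hx hAex := by
    rw [sum_shift, cutSize_disjSum, ind_of_notMem hzA, sub_zero]
    have h1 := h.hcut A hA hne hzA hx hAex
    have h2 := circNorm_add_le hk (∑ v ∈ A, β v) (r * ind A y)
    rw [abs_mul, Nat.abs_cast] at h2
    omega
  hex hc := absurd rfl hc

/-- An edge entering `z` can be deleted. If all edges at `z` leave it, edges from some `y` to `z`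
are added to raise the boundary of `y` to `k`, which also counts as negative, and the mixed case
applies. -/
lemma Preoriented.hasExtension_of_pos (hk : 3 ≤ k) (IH : ExtensionsBelow.{u, v} V k S.card)
    (h : Preoriented k S F s t σ β z z)
    (hpos : ∀ v ∈ S, v ≠ z → 2 * k ∣ β v ∨ IsPosMod k (β v)) : HasExtension k S F s t σ β z := by
  classical
  have hk0 : 0 < k := by omega
  induction hn : F.card using Nat.strong_induction_on generalizing F β with
  | _ n IHF =>
  subst hn
  by_cases hzero : ∃ v ∈ S, v ≠ z ∧ 2 * k ∣ β v
  · obtain ⟨v, hv, hvz, hβv⟩ := hzero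
    exact (h.with_exempt hv hβv).hasExtension_of_exempt hk0 IH hvz
  push Not at hzero
  rcases h.slack_or_hasExtension hk0 IH with h' | hslack
  · exact h'
  replace hpos : ∀ v ∈ S, v ≠ z → IsPosMod k (β v) := fun v hv hvz =>
    (hpos v hv hvz).resolve_left (hzero v hv hvz)
  by_cases hin : ∃ e ∈ F, ∃ x, x ≠ z ∧
      (s e = x ∧ t e = z ∧ σ e = 1 ∨ s e = z ∧ t e = x ∧ σ e = -1)
  · obtain ⟨e, he, x, hxz, hx⟩ := hin
    have hxS : x ∈ S := by
      rcases hx with ⟨h1, -, -⟩ | ⟨-, h1, -⟩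
      · exact h1 ▸ h.hs e he
      · exact h1 ▸ h.ht e he
    refine h.hasExtension_of_erase hk0 hslack he hxz hx (fun _ => hpos x hxS hxz)
      (fun hc => absurd rfl hc) (fun _ => rfl)
      fun h' => IHF _ (Finset.card_erase_lt_of_mem he) h' ?_ rfl
    intro v hv hvz
    obtain ⟨b, hb1, hb2, hb3⟩ := hpos v hv hvz
    by_cases hvx : x = v
    · subst hvx
      simp only [ind_singleton, if_true, hxz.symm, if_false]
      rcases hb1.eq_or_lt with hb | hb
      · left; subst hb; exact hb3.trans (dvd_of_eq (by ring))
      · right; exact ⟨b - 1, by omega, by omega, hb3.trans (dvd_of_eq (by ring))⟩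
    · right
      exact ⟨b, hb1, hb2, by simpa [ind_singleton, hvx, hvz.symm] using hb3⟩
  · have hout : netOut F s t σ {z} = cutSize F s t {z} := by
      refine Finset.sum_congr rfl fun e he => ?_
      have h1 := h.hσ e
      by_cases hsz : s e = z <;> by_cases htz : t e = z
      · simp [hsz, htz]
      · have h2 : σ e = 1 := h1.resolve_right fun hc =>
          hin ⟨e, he, t e, htz, Or.inr ⟨hsz, rfl, hc⟩⟩
        simp [hsz, htz, ind_singleton, h2]
      · have h2 : σ e = -1 := h1.resolve_left fun hc =>
          hin ⟨e, he, s e, hsz, Or.inl ⟨rfl, htz, hc⟩⟩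
        simp [hsz, htz, ind_singleton, h2]
      · simp [hsz, htz, ind_singleton]
    by_cases hy : ∃ y ∈ S, y ≠ z
    swap
    · push Not at hy
      refine h.hasExtension_of_card_le_two hk0 ((Finset.card_le_one.2 fun a ha b hb => ?_).trans
        one_le_two)
      rw [hy a ha, hy b hb]
    obtain ⟨y, hyS, hyz⟩ := hy
    by_cases hx : ∃ x ∈ S, x ≠ z ∧ x ≠ y
    swap
    · push Not at hx
      refine h.hasExtension_of_card_le_two hk0 ?_
      refine (Finset.card_le_card (t := {z, y}) fun x hxS => ?_).trans Finset.card_le_two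
      have := hx x hxS
      simp; tauto
    obtain ⟨x, hxS, hxz, hxy⟩ := hx
    obtain ⟨b, hb1, hb2, hb3⟩ := hpos y hyS hyz
    obtain ⟨r, hr⟩ : ∃ r : ℕ, (r : ℤ) = k - b := ⟨(k - b).toNat, by omega⟩
    have hnew := h.add_edges hk0 hyS hyz r (by omega) hout
    obtain ⟨τ, hτ, hτz, hτn⟩ := hnew.hasExtension_of_mixed hk IH hxS hyS hxz hyz hxy
      (Or.inr (by simpa [ind_singleton, hxz.symm, hxy.symm] using hpos x hxS hxz))
      (Or.inr ⟨k, by omega, le_rfl, by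
        simp only [ind_singleton, if_true, hyz.symm, if_false]
        rw [hr]
        have := dvd_add hb3 (dvd_refl (2 * k))
        rw [← dvd_neg] at this
        exact this.trans (dvd_of_eq (by ring))⟩)
    have hτr : ∀ i, τ (Sum.inr i) = 1 := fun i =>
      hτz (Sum.inr i) (by simp) (Or.inr rfl)
    have hτz' : ∀ e ∈ F, s e = z ∨ t e = z → (τ ∘ Sum.inl) e = σ e := fun e he hez =>
      hτz (Sum.inl e) (by simpa using he) hez
    refine ⟨τ ∘ Sum.inl, fun e => hτ _, hτz', fun v hv => ?_⟩
    obtain ⟨h1, h2⟩ := hτn v hv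
    rw [netOut_disjSum _ _ _ _ _ _ _ hτr] at h1 h2
    refine ⟨h1.trans (dvd_of_eq (by ring)), ?_⟩
    by_cases hvz : v = z
    · subst hvz
      rw [netOut_congr (σ' := σ) fun e he hne => hτz' e he (ends_of_ind_singleton_ne hne)]
      exact h.abs_netOut_lt hk0
    · by_cases hvy : v = y
      · subst hvy
        simp only [ind_singleton, if_true, hyz.symm, if_false, sub_zero, mul_one] at h1 h2
        rw [abs_lt] at h2 ⊢
        refine ⟨?_, by omega⟩
        -- With the added edges the net out-degree at `y` is `k` or `-k`; removing `r ≤ k - 1`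
        -- outgoing edges keeps it above `-2k`.
        have h3 : 2 * k ∣ netOut F s t (τ ∘ Sum.inl) {v} + r - k := by
          exact (dvd_add h1 hb3).trans (dvd_of_eq (by rw [hr]; ring))
        obtain ⟨j, hj⟩ := h3
        have : -2 < j := by nlinarith
        have : -1 ≤ j := by omega
        nlinarith
      · simpa [ind_singleton, Ne.symm hvy, Ne.symm hvz] using h2

lemma Preoriented.neg (hk : 0 < k) (h : Preoriented k S F s t σ β z z) :
    Preoriented k S F s t (-σ) (-β) z z where
  hz := h.hz
  hs := h.hs
  ht := h.ht
  hσ e := by rcases h.hσ e with h | h <;> simp [h]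
  hsum := by simpa using h.hsum
  hpar A hA := by
    have := h.hpar A hA
    simp only [Pi.neg_apply, Finset.sum_neg_distrib]
    omega
  hpre := by
    have := dvd_neg.2 h.hpre
    exact this.trans (dvd_of_eq (by simp [netOut]; ring))
  hdeg := by
    rw [Pi.neg_apply, circNorm_neg hk]; exact h.hdeg
  hcut A hA hne hzA hx hAex := by
    simp only [Pi.neg_apply, Finset.sum_neg_distrib]
    rw [circNorm_neg hk]; exact h.hcut A hA hne hzA hx hAex
  hex hc := absurd rfl hc

/-- The induction on vertices ranges over all edge sets, since the positive case adds edges.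
Reversing all edges reduces a single negative vertex among non-positive ones to the positive case.
-/
theorem Preoriented.hasExtension (hk : 3 ≤ k) (h : Preoriented k S F s t σ β z ex) :
    HasExtension k S F s t σ β z := by
  have hk0 : 0 < k := by omega
  induction hn : S.card using Nat.strong_induction_on generalizing E S F s t σ β z ex with
  | _ n IHn =>
  have IH : ExtensionsBelow.{u, v} V k S.card := fun E S' F s t σ β z ex hc h' =>
    IHn _ (hn ▸ hc) h' rfl
  by_cases hex : ex = z
  swap
  · exact h.hasExtension_of_exempt hk0 IH hex
  subst hex
  by_cases hneg : ∃ y ∈ S, y ≠ ex ∧ IsPosMod k (-β y)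
  swap
  · push Not at hneg
    refine h.hasExtension_of_pos hk IH fun v hv hvz => ?_
    have := isPosMod_trichotomy hk0 (β v)
    have := hneg v hv hvz
    tauto
  obtain ⟨y, hy, hyz, hβy⟩ := hneg
  by_cases hpos : ∃ x ∈ S, x ≠ ex ∧ x ≠ y ∧ IsPosMod k (β x)
  · obtain ⟨x, hx, hxz, hxy, hβx⟩ := hpos
    exact h.hasExtension_of_mixed hk IH hx hy hxz hyz hxy (Or.inr hβx) (Or.inr hβy)
  · push Not at hpos
    obtain ⟨τ, hτ, hτz, hτn⟩ := (h.neg hk0).hasExtension_of_pos hk IH fun v hv hvz => by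
      rw [Pi.neg_apply, dvd_neg]
      by_cases hvy : v = y
      · exact Or.inr (hvy ▸ hβy)
      · have := isPosMod_trichotomy hk0 (β v)
        have := hpos v hv hvz hvy
        tauto
    refine ⟨-τ, fun e => ?_, fun e he hez => ?_, fun v hv => ?_⟩
    · rcases hτ e with h | h <;> simp [h]
    · rw [Pi.neg_apply, hτz e he hez]; simp
    · have h1 : netOut F s t (-τ) {v} = - netOut F s t τ {v} := by simp [netOut]
      obtain ⟨h2, h3⟩ := hτn v hv
      rw [h1, abs_neg]
      exact ⟨(dvd_neg.2 h2).trans (dvd_of_eq (by simp; ring)), h3⟩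

/-! ### Orientations of `(3k-3)`-edge-connected graphs. -/

lemma two_dvd_cutSize_sub_sum {A : Finset V} (h : ∀ v ∈ A, (2 : ℤ) ∣ cutSize F s t {v} - β v) :
    (2 : ℤ) ∣ cutSize F s t A - ∑ v ∈ A, β v := by
  have habs : ∀ B : Finset V, (2 : ℤ) ∣ cutSize F s t B - netOut F s t (fun _ => 1) B := fun B => by
    unfold cutSize netOut
    rw [← Finset.sum_sub_distrib]
    refine Finset.dvd_sum fun e _ => ?_
    rcases abs_choice (ind B (s e) - ind B (t e)) with h | h <;> rw [h] <;> simp only [one_mul] <;> omega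
  have h1 : (2 : ℤ) ∣ ∑ v ∈ A, (netOut F s t (fun _ => 1) {v} - β v) :=
    Finset.dvd_sum fun v hv => by
      have h1 := h v hv
      have h2 := habs {v}
      omega
  rw [Finset.sum_sub_distrib, sum_netOut_singleton] at h1
  have := habs A
  omega

/-- A `(3 * k - 3)`-edge-connected graph has an orientation with prescribed net out-degrees modulo
`2 * k`, all of them smaller than `2 * k` in absolute value. -/
theorem exists_orientation (hk : 3 ≤ k) (hs : ∀ e ∈ F, s e ∈ S) (ht : ∀ e ∈ F, t e ∈ S)
    (hconn : ∀ A ⊆ S, A.Nonempty → A ≠ S → 3 * k - 3 ≤ cutSize F s t A)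
    (hsum : 2 * k ∣ ∑ v ∈ S, β v) (hpar : ∀ v ∈ S, (2 : ℤ) ∣ cutSize F s t {v} - β v) :
    ∃ τ : E → ℤ, (∀ e, τ e = 1 ∨ τ e = -1) ∧
      ∀ v ∈ S, 2 * k ∣ netOut F s t τ {v} - β v ∧ |netOut F s t τ {v}| < 2 * k := by
  have hk0 : 0 < k := by omega
  -- A new isolated vertex `none` plays the part of `z`, so that no edge is preoriented.
  obtain ⟨β', hβ'⟩ : ∃ β' : Option V → ℤ, β' = fun o => o.elim 0 β := ⟨_, rfl⟩
  have hind : ∀ (A : Finset (Option V)) x, ind A (some x) = ind A.eraseNone x := fun A x => by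
    simp [ind]
  have hcut : ∀ A : Finset (Option V), cutSize F (some ∘ s) (some ∘ t) A =
      cutSize F s t A.eraseNone := fun A => by simp [cutSize, hind]
  have hnet : ∀ (τ : E → ℤ) (A : Finset (Option V)), netOut F (some ∘ s) (some ∘ t) τ A =
      netOut F s t τ A.eraseNone := fun τ A => by simp [netOut, hind]
  have hβsum : ∀ A : Finset (Option V), ∑ v ∈ A, β' v = ∑ v ∈ A.eraseNone, β v := fun A => by
    have hmap : ∑ v ∈ A.eraseNone.map Function.Embedding.some, β' v = ∑ v ∈ A.eraseNone, β v := by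
      rw [Finset.sum_map, hβ']; rfl
    rw [← hmap, Finset.map_some_eraseNone]
    refine (Finset.sum_erase _ ?_).symm
    simp [hβ']
  have hsub : ∀ A ⊆ Finset.insertNone S, A.eraseNone ⊆ S := fun A hA x hx => by
    have := hA (Finset.mem_eraseNone.1 hx)
    simpa using this
  have hnone : ({none} : Finset (Option V)).eraseNone = ∅ := by ext; simp
  have hsome : ∀ v : V, ({some v} : Finset (Option V)).eraseNone = {v} := fun v => by ext; simp
  have h : Preoriented k (Finset.insertNone S) F (some ∘ s) (some ∘ t) (fun _ => 1) β' none none :=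
    { hz := by simp
      hs := fun e he => by simpa using hs e he
      ht := fun e he => by simpa using ht e he
      hσ := fun _ => Or.inl rfl
      hsum := by rw [hβsum, Finset.eraseNone_insertNone]; exact hsum
      hpar := fun A hA => by
        rw [hcut, hβsum]
        exact two_dvd_cutSize_sub_sum fun v hv => hpar v (hsub A hA hv)
      hpre := by rw [hnet, hnone]; simp [netOut, hβ', ind]
      hdeg := by
        rw [hcut, hnone]
        have := circNorm_nonneg hk0 (β' none)
        simp only [cutSize, ind, Finset.notMem_empty, if_false, sub_self, abs_zero,
          Finset.sum_const_zero]
        omega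
      hcut := fun A hA hne hzA hx _ => by
        rw [hcut, hβsum]
        obtain ⟨x, hxS, hxn, hxA⟩ := hx
        obtain ⟨x, rfl⟩ := Option.ne_none_iff_exists'.1 hxn
        have h1 := hconn A.eraseNone (hsub A hA) (by
          obtain ⟨a, ha⟩ := hne
          cases a with
          | none => exact absurd ha hzA
          | some a => exact ⟨a, by simpa using ha⟩) (by
          intro hc
          have h2 : x ∈ A.eraseNone := by rw [hc]; simpa using hxS
          exact hxA (by simpa using h2))
        -- Up to `3k - 2` edges are required, one more than assumed; parity supplies the missing
        -- edge when the norm is `k`.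
        have h2 := two_dvd_cutSize_sub_sum (F := F) (s := s) (t := t) (β := β)
          (A := A.eraseNone) fun v hv => hpar v (hsub A hA hv)
        have h3 := two_dvd_circNorm_sub hk0 (∑ v ∈ A.eraseNone, β v)
        have h4 := circNorm_le (k := k) (∑ v ∈ A.eraseNone, β v)
        omega
      hex := fun hc => absurd rfl hc }
  obtain ⟨τ, hτ, -, hτn⟩ := h.hasExtension hk
  refine ⟨τ, hτ, fun v hv => ?_⟩
  have := hτn (some v) (by simpa using hv)
  rw [hnet, hsome] at this
  simpa [hβ'] using this


/-! ### Signing the edges inside the classes. -/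

/-- After cancelling common factors the congruence determines `j` modulo `m`: for odd `k` because 2
is invertible, for even `k` because 4 divides everything. Hence `m - 1` edges inside the classes
suffice. -/
lemma exists_small_solution {k m c N : ℤ} (hm : 0 < m) (hkm : k = m ∧ Odd k ∨ k = 2 * m)
    (hc : (2 : ℤ) ∣ c) (hc4 : k = 2 * m → (4 : ℤ) ∣ c - 2 * N) :
    ∃ j : ℕ, (j : ℤ) ≤ m - 1 ∧ 2 * k ∣ 4 * j - (c + 2 * N) := by
  have key : ∀ g : ℤ, ∃ j : ℕ, (j : ℤ) ≤ m - 1 ∧ m ∣ j - g := fun g => by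
    have h1 := Int.emod_nonneg g hm.ne'
    have h2 := Int.emod_lt_of_pos g hm
    refine ⟨(g % m).toNat, by omega, -(g / m), ?_⟩
    have := Int.emod_add_mul_ediv g m
    rw [Int.toNat_of_nonneg h1]
    linarith
  rcases hkm with ⟨rfl, l, hl⟩ | h
  · obtain ⟨g, rfl⟩ := hc
    -- As `k = 2l + 1`, the inverse of 2 modulo `k` is `l + 1`.
    obtain ⟨j, hj1, i, hi⟩ := key ((g + N) * (l + 1))
    refine ⟨j, hj1, 2 * i + (g + N), ?_⟩
    linear_combination 4 * hi - 2 * (g + N) * hl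
  · obtain ⟨g, hg⟩ := hc4 h
    obtain ⟨j, hj1, i, hi⟩ := key (g + N)
    refine ⟨j, hj1, i, ?_⟩
    rw [h]
    linear_combination 4 * hi - hg

/-- Both ends of such an edge carry the same class sign, so its contributions add up instead of
cancelling. This is the leverage of `M` on the total boundary. -/
lemma sum_sign_ind {M : Finset E} (hs : ∀ e ∈ M, s e ∈ S) (ht : ∀ e ∈ M, t e ∈ S) (sg : V → ℤ)
    (hM : ∀ e ∈ M, sg (s e) = sg (t e)) (ρ : E → ℤ) :
    ∑ v ∈ S, sg v * ∑ e ∈ M, ρ e * (ind {v} (s e) + ind {v} (t e)) =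
      2 * ∑ e ∈ M, ρ e * sg (s e) := by
  simp_rw [Finset.mul_sum]
  rw [Finset.sum_comm]
  refine Finset.sum_congr rfl fun e he => ?_
  have h1 : ∀ x ∈ S, ∑ v ∈ S, sg v * ind {v} x = sg x := fun x hx => by simp [ind, hx]
  have h2 : ∀ v, sg v * (ρ e * (ind {v} (s e) + ind {v} (t e))) =
      ρ e * (sg v * ind {v} (s e)) + ρ e * (sg v * ind {v} (t e)) := fun v => by ring
  simp_rw [h2]
  rw [Finset.sum_add_distrib, ← Finset.mul_sum, ← Finset.mul_sum, h1 _ (hs e he), h1 _ (ht e he),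
    ← hM e he]
  ring

lemma exists_signs_sum_eq (M : Finset E) (c : E → ℤ) (hc : ∀ e, c e = 1 ∨ c e = -1) (j : ℕ)
    (hj : j ≤ M.card) :
    ∃ ρ : E → ℤ, (∀ e, ρ e = 1 ∨ ρ e = -1) ∧ ∑ e ∈ M, ρ e * c e = 2 * j - M.card := by
  classical
  obtain ⟨T, hTM, hT⟩ := Finset.exists_subset_card_eq hj
  refine ⟨fun e => if e ∈ T then c e else -c e, fun e => ?_, ?_⟩
  · rcases hc e with h | h <;> by_cases he : e ∈ T <;> simp [h, he]
  · have h1 : ∀ e, c e * c e = 1 := fun e => by rcases hc e with h | h <;> simp [h]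
    rw [← Finset.sum_sdiff hTM, Finset.sum_congr rfl (g := fun _ => (1 : ℤ)) (s₁ := T)
      (by intro e he; simp [he, h1]), Finset.sum_congr rfl (g := fun _ => (-1 : ℤ)) (s₁ := M \ T)
      (by intro e he; simp [(Finset.mem_sdiff.1 he).2, h1])]
    have h2 := Finset.card_sdiff_add_card_eq_card hTM
    simp only [Finset.sum_const, nsmul_eq_mul, mul_neg, mul_one]
    omega

/-- The signs of the edges of `M` can be chosen freely when each vertex has degree at most `m` in
`M`. -/
lemma exists_signs_of_degree_le {m : ℤ} (hk : 3 ≤ k) (hm : 0 < m)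
    (hkm : k = m ∧ Odd k ∨ k = 2 * m) {sg : V → ℤ} (hsg : ∀ v, sg v = 1 ∨ sg v = -1)
    {M : Finset E} (hs : ∀ e ∈ F, s e ∈ S) (ht : ∀ e ∈ F, t e ∈ S) (hsM : ∀ e ∈ M, s e ∈ S)
    (htM : ∀ e ∈ M, t e ∈ S) (hM : ∀ e ∈ M, sg (s e) = sg (t e))
    (hconn : ∀ A ⊆ S, A.Nonempty → A ≠ S → 3 * k - 3 ≤ cutSize F s t A) {γ : V → ℤ}
    (hpar : ∀ v ∈ S, (2 : ℤ) ∣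
      cutSize F s t {v} + ∑ e ∈ M, (ind {v} (s e) + ind {v} (t e)) - γ v)
    (hγ : (2 : ℤ) ∣ ∑ v ∈ S, sg v * γ v)
    (hγ4 : k = 2 * m → (4 : ℤ) ∣ ∑ v ∈ S, sg v * γ v - 2 * M.card) (hcard : m - 1 ≤ M.card)
    (hdeg : ∀ v ∈ S, ∑ e ∈ M, (ind {v} (s e) + ind {v} (t e)) ≤ m) :
    ∃ σ ρ : E → ℤ, (∀ e, σ e = 1 ∨ σ e = -1) ∧ (∀ e, ρ e = 1 ∨ ρ e = -1) ∧ ∀ v ∈ S,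
      2 * k ∣ sg v * netOut F s t σ {v} + ∑ e ∈ M, ρ e * (ind {v} (s e) + ind {v} (t e)) - γ v ∧
      |sg v * netOut F s t σ {v} + ∑ e ∈ M, ρ e * (ind {v} (s e) + ind {v} (t e))| ≤
        2 * k - 1 + m := by
  have hsg2 : ∀ v, sg v * sg v = 1 := fun v => by rcases hsg v with h | h <;> simp [h]
  have hnn : ∀ (v : V) e, 0 ≤ ind {v} (s e) + ind {v} (t e) := fun v e => by
    rcases ind_cases {v} (s e) with h | h <;> rcases ind_cases {v} (t e) with h' | h' <;>
      simp [h, h']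
  obtain ⟨j, hj, hjk⟩ := exists_small_solution (N := M.card) hm hkm hγ hγ4
  obtain ⟨ρ, hρ, hρM⟩ := exists_signs_sum_eq M (fun e => sg (s e)) (fun e => hsg _) j (by omega)
  obtain ⟨d, hd⟩ : ∃ d : V → ℤ, d = fun v => ∑ e ∈ M, ρ e * (ind {v} (s e) + ind {v} (t e)) :=
    ⟨_, rfl⟩
  have hdv : ∀ v, ∑ e ∈ M, ρ e * (ind {v} (s e) + ind {v} (t e)) = d v := fun v => by rw [hd]
  have hdabs : ∀ v ∈ S, |d v| ≤ m := fun v hv => by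
    rw [← hdv]
    refine (Finset.abs_sum_le_sum_abs _ _).trans (le_trans (le_of_eq ?_) (hdeg v hv))
    refine Finset.sum_congr rfl fun e _ => ?_
    rw [abs_mul, abs_of_nonneg (hnn v e)]
    rcases hρ e with h | h <;> simp [h]
  have hdpar : ∀ v, (2 : ℤ) ∣ d v - ∑ e ∈ M, (ind {v} (s e) + ind {v} (t e)) := fun v => by
    rw [← hdv, ← Finset.sum_sub_distrib]
    refine Finset.dvd_sum fun e _ => ?_
    rcases hρ e with h | h <;> rw [h] <;> omega
  obtain ⟨σ, hσ, hσn⟩ := exists_orientation (β := fun v => sg v * (γ v - d v)) hk hs ht hconn (by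
      have h1 := sum_sign_ind hsM htM sg hM ρ
      simp_rw [hdv] at h1
      rw [hρM] at h1
      simp_rw [mul_sub]
      rw [Finset.sum_sub_distrib, h1]
      exact (dvd_neg.2 hjk).trans (dvd_of_eq (by ring))) (fun v hv => by
      have h1 := hpar v hv
      have h2 := hdpar v
      rcases hsg v with h | h <;> simp only [h, one_mul, neg_one_mul] <;> omega)
  refine ⟨σ, ρ, hσ, hρ, fun v hv => ?_⟩
  rw [hdv]
  obtain ⟨h1, h2⟩ := hσn v hv
  constructor
  · have h3 := dvd_mul_of_dvd_right h1 (sg v)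
    refine h3.trans (dvd_of_eq ?_)
    linear_combination -(γ v - d v) * hsg2 v
  · have h3 := hdabs v hv
    have h4 : |sg v * netOut F s t σ {v}| = |netOut F s t σ {v}| := by
      rw [abs_mul]; rcases hsg v with h | h <;> simp [h]
    have := abs_add_le (sg v * netOut F s t σ {v}) (d v)
    omega

lemma sum_eq_add_add_sum_erase_erase [DecidableEq E] {M : Finset E} {e f : E} (he : e ∈ M)
    (hf : f ∈ M) (hef : e ≠ f) (g : E → ℤ) :
    ∑ x ∈ M, g x = g e + g f + ∑ x ∈ (M.erase e).erase f, g x := by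
  rw [← Finset.add_sum_erase M g he, ← Finset.add_sum_erase (M.erase e) g
    (Finset.mem_erase.2 ⟨hef.symm, hf⟩)]
  ring

/-- Two edges of `M` sharing a vertex `v` are given opposite signs: they cancel at `v` and act as
one oriented edge between their other ends, which is moved into `F`. This is repeated until `M` has
at most `m` edges or no two of them meet. -/
theorem exists_signs {m : ℤ} (hk : 3 ≤ k) (hm : 0 < m)
    (hkm : k = m ∧ Odd k ∨ k = 2 * m) {sg : V → ℤ} (hsg : ∀ v, sg v = 1 ∨ sg v = -1)
    {M : Finset E} (hFM : Disjoint F M) (hs : ∀ e ∈ F, s e ∈ S) (ht : ∀ e ∈ F, t e ∈ S)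
    (hsM : ∀ e ∈ M, s e ∈ S) (htM : ∀ e ∈ M, t e ∈ S) (hM : ∀ e ∈ M, sg (s e) = sg (t e))
    (hloop : ∀ e ∈ M, s e ≠ t e)
    (hconn : ∀ A ⊆ S, A.Nonempty → A ≠ S → 3 * k - 3 ≤ cutSize F s t A) {γ : V → ℤ}
    (hpar : ∀ v ∈ S, (2 : ℤ) ∣
      cutSize F s t {v} + ∑ e ∈ M, (ind {v} (s e) + ind {v} (t e)) - γ v)
    (hγ : (2 : ℤ) ∣ ∑ v ∈ S, sg v * γ v)
    (hγ4 : k = 2 * m → (4 : ℤ) ∣ ∑ v ∈ S, sg v * γ v - 2 * M.card) (hcard : m - 1 ≤ M.card) :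
    ∃ σ ρ : E → ℤ, (∀ e, σ e = 1 ∨ σ e = -1) ∧ (∀ e, ρ e = 1 ∨ ρ e = -1) ∧ ∀ v ∈ S,
      2 * k ∣ sg v * netOut F s t σ {v} + ∑ e ∈ M, ρ e * (ind {v} (s e) + ind {v} (t e)) - γ v ∧
      |sg v * netOut F s t σ {v} + ∑ e ∈ M, ρ e * (ind {v} (s e) + ind {v} (t e))| ≤
        2 * k - 1 + m := by
  classical
  induction hn : M.card using Nat.strong_induction_on generalizing F M s t with
  | _ n IH =>
  subst hn
  have hle1 : ∀ v, ∀ e ∈ M, ind {v} (s e) + ind {v} (t e) ≤ 1 := fun v e he => by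
    have := hloop e he
    simp only [ind_singleton]
    split_ifs with h1 h2
    · exact absurd (h1.trans h2.symm) this
    all_goals norm_num
  -- Pairs are removed only above `m` edges, so at least `m - 1` always remain.
  by_cases hsmall : (M.card : ℤ) ≤ m
  · refine exists_signs_of_degree_le hk hm hkm hsg hs ht hsM htM hM hconn hpar hγ hγ4 hcard
      fun v _ => (Finset.sum_le_card_nsmul _ _ _ (hle1 v)).trans ?_
    simpa using hsmall
  by_cases hpair : ∃ e ∈ M, ∃ f ∈ M, e ≠ f ∧ ∃ v, ind {v} (s e) ≠ ind {v} (t e) ∧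
      ind {v} (s f) ≠ ind {v} (t f)
  swap
  · refine exists_signs_of_degree_le hk hm hkm hsg hs ht hsM htM hM hconn hpar hγ hγ4 hcard
      fun v _ => ?_
    refine le_trans ?_ (show (1 : ℤ) ≤ m by omega)
    by_cases hv : ∃ e ∈ M, ind {v} (s e) ≠ ind {v} (t e)
    · obtain ⟨e, he, hev⟩ := hv
      rw [Finset.sum_eq_single_of_mem e he fun f hf hfe => ?_]
      · exact hle1 v e he
      · by_contra hc
        refine hpair ⟨e, he, f, hf, hfe.symm, v, hev, fun heq => hc ?_⟩
        have := hle1 v f hf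
        rcases ind_cases {v} (s f) with h1 | h1 <;> omega
    · push Not at hv
      rw [Finset.sum_eq_zero fun e he => ?_]
      · norm_num
      · have h1 := hv e he
        have := hle1 v e he
        rcases ind_cases {v} (s e) with h2 | h2 <;> omega
  obtain ⟨e, he, f, hf, hef, v, hev, hfv⟩ := hpair
  obtain ⟨u, -, ε, hu⟩ := exists_other_end hev
  obtain ⟨w, -, δ, hw⟩ := exists_other_end hfv
  have heF : e ∉ F := fun hc => Finset.disjoint_left.1 hFM hc he
  have hue : ∀ A, ind A (s e) + ind A (t e) = ind A u + ind A v := fun A => by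
    rcases hu with ⟨h1, h2, -⟩ | ⟨h1, h2, -⟩ <;> rw [h1, h2]; ring
  have hwf : ∀ A, ind A (s f) + ind A (t f) = ind A w + ind A v := fun A => by
    rcases hw with ⟨h1, h2, -⟩ | ⟨h1, h2, -⟩ <;> rw [h1, h2]; ring
  have huS : u ∈ S := by
    rcases hu with ⟨h1, h2, -⟩ | ⟨h1, h2, -⟩
    · exact h1 ▸ hsM e he
    · exact h2 ▸ htM e he
  have hwS : w ∈ S := by
    rcases hw with ⟨h1, h2, -⟩ | ⟨h1, h2, -⟩
    · exact h1 ▸ hsM f hf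
    · exact h2 ▸ htM f hf
  have hsu : sg u = sg v := by
    have := hM e he
    rcases hu with ⟨h1, h2, -⟩ | ⟨h1, h2, -⟩ <;> rw [h1, h2] at this
    exacts [this, this.symm]
  have hsw : sg w = sg v := by
    have := hM f hf
    rcases hw with ⟨h1, h2, -⟩ | ⟨h1, h2, -⟩ <;> rw [h1, h2] at this
    exacts [this, this.symm]
  obtain ⟨s', hs'⟩ : ∃ s', s' = Function.update s e u := ⟨_, rfl⟩
  obtain ⟨t', ht'⟩ : ∃ t', t' = Function.update t e w := ⟨_, rfl⟩
  obtain ⟨M', hM'⟩ : ∃ M', M' = (M.erase e).erase f := ⟨_, rfl⟩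
  have hMM : ∀ x ∈ M', x ≠ e ∧ x ≠ f ∧ x ∈ M := fun x hx => by
    simp only [hM', Finset.mem_erase] at hx; tauto
  have hs'x : ∀ x, x ≠ e → s' x = s x := fun x hx => by rw [hs', Function.update_of_ne hx]
  have ht'x : ∀ x, x ≠ e → t' x = t x := fun x hx => by rw [ht', Function.update_of_ne hx]
  have hs'e : s' e = u := by rw [hs', Function.update_self]
  have ht'e : t' e = w := by rw [ht', Function.update_self]
  have hFne : ∀ x ∈ F, x ≠ e := fun x hx hc => heF (hc ▸ hx)
  have hcut' : ∀ A, cutSize (insert e F) s' t' A = |ind A u - ind A w| + cutSize F s t A :=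
    fun A => by
      unfold cutSize
      rw [Finset.sum_insert heF, hs'e, ht'e]
      congr 1
      exact Finset.sum_congr rfl fun x hx => by rw [hs'x x (hFne x hx), ht'x x (hFne x hx)]
  have hnet' : ∀ τ A, netOut (insert e F) s' t' τ A =
      τ e * (ind A u - ind A w) + netOut F s t τ A := fun τ A => by
    unfold netOut
    rw [Finset.sum_insert heF, hs'e, ht'e]
    congr 1
    exact Finset.sum_congr rfl fun x hx => by rw [hs'x x (hFne x hx), ht'x x (hFne x hx)]
  have hcardM : M'.card + 2 = M.card := by
    rw [hM', Finset.card_erase_of_mem (Finset.mem_erase.2 ⟨hef.symm, hf⟩),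
      Finset.card_erase_of_mem he]
    have : 1 < M.card := Finset.one_lt_card.2 ⟨e, he, f, hf, hef⟩
    omega
  have hsum' : ∀ (g : E → ℤ) (A : Finset V), ∑ x ∈ M', g x * (ind A (s' x) + ind A (t' x)) =
      ∑ x ∈ M', g x * (ind A (s x) + ind A (t x)) := fun g A =>
    Finset.sum_congr rfl fun x hx => by rw [hs'x x (hMM x hx).1, ht'x x (hMM x hx).1]
  obtain ⟨σ, ρ, hσ, hρ, hbal⟩ := IH M'.card (by omega) (F := insert e F) (M := M') (s := s')
    (t := t')
    (by
      refine Finset.disjoint_left.2 fun x hx hxM => ?_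
      rcases Finset.mem_insert.1 hx with rfl | hx
      · exact (hMM x hxM).1 rfl
      · exact Finset.disjoint_left.1 hFM hx (hMM x hxM).2.2)
    (fun x hx => by
      rcases Finset.mem_insert.1 hx with rfl | hx
      · rwa [hs'e]
      · rw [hs'x x (hFne x hx)]; exact hs x hx)
    (fun x hx => by
      rcases Finset.mem_insert.1 hx with rfl | hx
      · rwa [ht'e]
      · rw [ht'x x (hFne x hx)]; exact ht x hx)
    (fun x hx => by rw [hs'x x (hMM x hx).1]; exact hsM x (hMM x hx).2.2)
    (fun x hx => by rw [ht'x x (hMM x hx).1]; exact htM x (hMM x hx).2.2)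
    (fun x hx => by
      rw [hs'x x (hMM x hx).1, ht'x x (hMM x hx).1]; exact hM x (hMM x hx).2.2)
    (fun x hx => by
      rw [hs'x x (hMM x hx).1, ht'x x (hMM x hx).1]; exact hloop x (hMM x hx).2.2)
    (fun A hA hne hAS => by
      rw [hcut']
      have := hconn A hA hne hAS
      have := abs_nonneg (ind A u - ind A w)
      omega)
    (fun x hx => by
      have h1 := hpar x hx
      have h2 := hsum' (fun _ => 1) {x}
      simp only [one_mul] at h2
      rw [sum_eq_add_add_sum_erase_erase he hf hef, hue, hwf, ← hM', ← h2] at h1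
      rw [hcut']
      rcases abs_choice (ind {x} u - ind {x} w) with h | h <;> rw [h] <;> omega)
    (fun h => by have := hγ4 h; omega) (by omega) rfl
  refine ⟨σ, Function.update (Function.update ρ e (sg v * σ e)) f (-(sg v * σ e)), hσ,
    fun x => ?_, fun x hx => ?_⟩
  · have h1 : sg v * σ e = 1 ∨ sg v * σ e = -1 := by
      rcases hsg v with h | h <;> rcases hσ e with h' | h' <;> simp [h, h']
    by_cases hxf : x = f
    · subst hxf; rw [Function.update_self]; omega
    · rw [Function.update_of_ne hxf]
      by_cases hxe : x = e
      · subst hxe; rwa [Function.update_self]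
      · rw [Function.update_of_ne hxe]; exact hρ x
  · have h1 := hbal x hx
    have h2 : ∀ y, sg x * ind {x} y = sg y * ind {x} y := fun y => by
      rw [ind_singleton]; split_ifs with h
      · rw [h]
      · simp
    rw [sum_eq_add_add_sum_erase_erase he hf hef, ← hM', Finset.sum_congr rfl (s₁ := M')
      (g := fun y => ρ y * (ind {x} (s y) + ind {x} (t y))) (fun y hy => by
        rw [Function.update_of_ne (hMM y hy).2.1, Function.update_of_ne (hMM y hy).1]),
      Function.update_self, Function.update_of_ne hef, Function.update_self, hue, hwf]
    rw [hnet', hsum'] at h1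
    have h3 : sg x * (σ e * (ind {x} u - ind {x} w) + netOut F s t σ {x}) +
        ∑ y ∈ M', ρ y * (ind {x} (s y) + ind {x} (t y)) = sg x * netOut F s t σ {x} +
        (sg v * σ e * (ind {x} u + ind {x} v) + -(sg v * σ e) * (ind {x} w + ind {x} v) +
          ∑ y ∈ M', ρ y * (ind {x} (s y) + ind {x} (t y))) := by
      have h4 := h2 u
      have h5 := h2 w
      rw [hsu] at h4
      rw [hsw] at h5
      linear_combination σ e * h4 - σ e * h5
    rwa [h3] at h1

/-! ### Maximum cuts. -/

lemma ind_symmDiff (A X : Finset V) (x : V) :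
    ind (symmDiff A X) x = ind A x + ind X x - 2 * ind A x * ind X x := by
  by_cases h1 : x ∈ A <;> by_cases h2 : x ∈ X <;> simp [ind, Finset.mem_symmDiff, h1, h2]

lemma ind_eq_ind_iff (X : Finset V) (x y : V) : ind X x = ind X y ↔ (x ∈ X ↔ y ∈ X) := by
  by_cases h1 : x ∈ X <;> by_cases h2 : y ∈ X <;> simp [ind, h1, h2]

/-- A maximum cut contains at least half of the edges of every cut. -/
lemma cutSize_le_two_mul_of_max {X A : Finset V}
    (hmax : cutSize F s t (symmDiff A X) ≤ cutSize F s t X) :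
    cutSize F s t A ≤ 2 * cutSize {e ∈ F | ¬ ind X (s e) = ind X (t e)} s t A := by
  have h1 : cutSize F s t (symmDiff A X) = cutSize F s t A + cutSize F s t X -
      2 * cutSize {e ∈ F | ¬ ind X (s e) = ind X (t e)} s t A := by
    unfold cutSize
    rw [Finset.sum_filter, Finset.mul_sum, ← Finset.sum_add_distrib, ← Finset.sum_sub_distrib]
    refine Finset.sum_congr rfl fun e _ => ?_
    rw [ind_symmDiff, ind_symmDiff]
    rcases ind_cases A (s e) with h1 | h1 <;> rcases ind_cases A (t e) with h2 | h2 <;>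
      rcases ind_cases X (s e) with h3 | h3 <;> rcases ind_cases X (t e) with h4 | h4 <;>
      simp [h1, h2, h3, h4]
  omega

/-- In a loopless `(6 * k - 7)`-edge-connected graph of large bipartite index, the edges can be
signed so that the sums of the signs at the vertices are small and have prescribed residues. -/
theorem exists_signs_of_edgeConnected {m : ℤ} (hk : 3 ≤ k) (hm : 0 < m)
    (hkm : k = m ∧ Odd k ∨ k = 2 * m) (hs : ∀ e ∈ F, s e ∈ S) (ht : ∀ e ∈ F, t e ∈ S)
    (hloop : ∀ e ∈ F, s e ≠ t e)
    (hconn : ∀ A ⊆ S, A.Nonempty → A ≠ S → 6 * k - 7 ≤ cutSize F s t A) (f : V → ℤ)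
    (hf : k = 2 * m → (2 : ℤ) ∣ ∑ v ∈ S, f v)
    (hbip : ∀ X ⊆ S, m - 1 ≤ {e ∈ F | ind X (s e) = ind X (t e)}.card) :
    ∃ ρ : E → ℤ, (∀ e, ρ e = 1 ∨ ρ e = -1) ∧ ∀ v ∈ S,
      2 * k ∣ ∑ e ∈ F, ρ e * (ind {v} (s e) + ind {v} (t e)) -
        (2 * f v - ∑ e ∈ F, (ind {v} (s e) + ind {v} (t e))) ∧
      |∑ e ∈ F, ρ e * (ind {v} (s e) + ind {v} (t e))| ≤ 2 * k - 1 + m := by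
  classical
  obtain ⟨X, hXS, hmax⟩ := Finset.exists_max_image S.powerset (fun X => cutSize F s t X)
    ⟨∅, by simp⟩
  rw [Finset.mem_powerset] at hXS
  obtain ⟨B, hB⟩ : ∃ B, B = {e ∈ F | ¬ ind X (s e) = ind X (t e)} := ⟨_, rfl⟩
  obtain ⟨M, hM⟩ : ∃ M, M = {e ∈ F | ind X (s e) = ind X (t e)} := ⟨_, rfl⟩
  have hBF : ∀ e ∈ B, e ∈ F ∧ ¬ ind X (s e) = ind X (t e) := fun e he => by simpa [hB] using he
  have hMF : ∀ e ∈ M, e ∈ F ∧ ind X (s e) = ind X (t e) := fun e he => by simpa [hM] using he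
  have hsum : ∀ g : E → ℤ, ∑ e ∈ F, g e = ∑ e ∈ M, g e + ∑ e ∈ B, g e := fun g => by
    rw [hM, hB, Finset.sum_filter_add_sum_filter_not]
  obtain ⟨sg, hsg'⟩ : ∃ sg : V → ℤ, sg = fun v => 2 * ind X v - 1 := ⟨_, rfl⟩
  have hsg : ∀ v, sg v = 1 ∨ sg v = -1 := fun v => by
    rcases ind_cases X v with h | h <;> simp [hsg', h]
  have hsgM : ∀ e ∈ M, sg (s e) = sg (t e) := fun e he => by simp [hsg', (hMF e he).2]
  have hsgB : ∀ e ∈ B, sg (t e) = - sg (s e) := fun e he => by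
    have := (hBF e he).2
    rcases ind_cases X (s e) with h | h <;> rcases ind_cases X (t e) with h' | h' <;>
      simp [hsg', h, h'] at this ⊢
  -- The dictionary between orientations and signings of crossing edges: an edge gets sign `1`
  -- exactly when it is directed out of `X`.
  have hBalt : ∀ v, ∀ e ∈ B, sg v * (ind {v} (s e) - ind {v} (t e)) =
      sg (s e) * (ind {v} (s e) + ind {v} (t e)) := fun v e he => by
    have h1 := hsgB e he
    have h2 : ∀ x, sg v * ind {v} x = sg x * ind {v} x := fun x => by
      rw [ind_singleton]; split_ifs with h
      · rw [h]
      · simp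
    have h3 := h2 (s e)
    have h4 := h2 (t e)
    rw [h1] at h4
    linear_combination h3 - h4
  have hΓ : ∑ v ∈ S, sg v * (2 * f v - ∑ e ∈ F, (ind {v} (s e) + ind {v} (t e))) =
      2 * (∑ v ∈ S, sg v * f v - ∑ e ∈ M, sg (s e)) := by
    have h1 := sum_sign_ind (M := M) (fun e he => hs e (hMF e he).1) (fun e he => ht e (hMF e he).1)
      sg hsgM (fun _ => 1)
    have h2 : ∑ v ∈ S, sg v * ∑ e ∈ B, (ind {v} (s e) + ind {v} (t e)) = 0 := by
      simp_rw [Finset.mul_sum]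
      rw [Finset.sum_comm]
      refine Finset.sum_eq_zero fun e he => ?_
      have h1 : ∀ x ∈ S, ∑ v ∈ S, sg v * ind {v} x = sg x := fun x hx => by simp [ind, hx]
      simp_rw [mul_add]
      rw [Finset.sum_add_distrib, h1 _ (hs e (hBF e he).1), h1 _ (ht e (hBF e he).1), hsgB e he]
      ring
    simp only [one_mul] at h1
    have h3 : ∀ v, sg v * (2 * f v - ∑ e ∈ F, (ind {v} (s e) + ind {v} (t e))) =
        2 * (sg v * f v) - sg v * ∑ e ∈ M, (ind {v} (s e) + ind {v} (t e)) -
          sg v * ∑ e ∈ B, (ind {v} (s e) + ind {v} (t e)) := fun v => by rw [hsum]; ring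
    simp_rw [h3]
    rw [Finset.sum_sub_distrib, Finset.sum_sub_distrib, h1, h2, ← Finset.mul_sum]
    ring
  obtain ⟨σ, ρ, hσ, hρ, hbal⟩ := exists_signs (F := B) (M := M) hk hm hkm hsg
    (Finset.disjoint_left.2 fun e h1 h2 => (hBF e h1).2 (hMF e h2).2)
    (fun e he => hs e (hBF e he).1) (fun e he => ht e (hBF e he).1)
    (fun e he => hs e (hMF e he).1) (fun e he => ht e (hMF e he).1) hsgM
    (fun e he => hloop e (hMF e he).1)
    (fun A hA hne hAS => by
      have h1 := cutSize_le_two_mul_of_max (hmax (symmDiff A X) (by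
        rw [Finset.mem_powerset]
        exact Finset.symmDiff_subset_union.trans (Finset.union_subset hA hXS)))
      -- Half of `6k - 7`, rounded up, is `3k - 3`.
      have h2 := hconn A hA hne hAS
      rw [← hB] at h1
      omega)
    (γ := fun v => 2 * f v - ∑ e ∈ F, (ind {v} (s e) + ind {v} (t e)))
    (fun v hv => by
      have h1 : (2 : ℤ) ∣ cutSize B s t {v} - ∑ e ∈ B, (ind {v} (s e) + ind {v} (t e)) := by
        unfold cutSize
        rw [← Finset.sum_sub_distrib]
        refine Finset.dvd_sum fun e _ => ?_
        rcases abs_choice (ind {v} (s e) - ind {v} (t e)) with h | h <;> rw [h] <;> omega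
      rw [hsum]
      omega)
    (by rw [hΓ]; exact dvd_mul_right _ _)
    (fun hkm2 => by
      rw [hΓ]
      -- Class signs are irrelevant modulo 2, so the required divisibility by 4 reduces to the
      -- evenness of the sum of `f`.
      have h1 : (2 : ℤ) ∣ ∑ v ∈ S, sg v * f v - ∑ v ∈ S, f v := by
        rw [← Finset.sum_sub_distrib]
        refine Finset.dvd_sum fun v _ => ?_
        rcases hsg v with h | h <;> rw [h] <;> omega
      have h2 : (2 : ℤ) ∣ ∑ e ∈ M, sg (s e) - M.card := by
        rw [Finset.card_eq_sum_ones, Nat.cast_sum, ← Finset.sum_sub_distrib]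
        refine Finset.dvd_sum fun e _ => ?_
        rcases hsg (s e) with h | h <;> rw [h] <;> norm_num
      have h3 := hf hkm2
      omega)
    (by rw [hM]; exact hbip X hXS)
  refine ⟨fun e => if ind X (s e) = ind X (t e) then ρ e else sg (s e) * σ e, fun e => ?_,
    fun v hv => ?_⟩
  · dsimp only
    split_ifs
    · exact hρ e
    · rcases hsg (s e) with h | h <;> rcases hσ e with h' | h' <;> simp [h, h']
  · have h1 : ∑ e ∈ F, (if ind X (s e) = ind X (t e) then ρ e else sg (s e) * σ e) *
        (ind {v} (s e) + ind {v} (t e)) =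
        sg v * netOut B s t σ {v} + ∑ e ∈ M, ρ e * (ind {v} (s e) + ind {v} (t e)) := by
      rw [hsum, add_comm, netOut, Finset.mul_sum]
      congr 1
      · refine Finset.sum_congr rfl fun e he => ?_
        rw [if_neg (hBF e he).2]
        linear_combination -(σ e) * hBalt v e he
      · exact Finset.sum_congr rfl fun e he => by rw [if_pos (hMF e he).2]
    rw [h1]
    exact hbal v hv

end EdgeSystems

/-! ### Multigraphs and the final theorem. -/

namespace Graph

variable {α β : Type*}

lemma degree_eq_sum [DecidableEq α] {G : Graph α β} (hloop : G.Loopless) {s t : β → α}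
    {F : Finset β} (hF : ∀ e, e ∈ F ↔ e ∈ E(G)) (hst : ∀ e ∈ E(G), G.IsLink e (s e) (t e)) (v : α) :
    (G.degree v : ℤ) = ∑ e ∈ F, (ind {v} (s e) + ind {v} (t e)) := by
  have h1 : G.loopSet v = ∅ := by
    ext e
    simp [Graph.not_isLoopAt]
  have h2 : G.incidenceSet v = ({e ∈ F | s e = v ∨ t e = v} : Finset β) := by
    ext e
    simp only [mem_incidenceSet, Finset.coe_filter, Set.mem_ofPred_eq, hF]
    constructor
    · intro he
      exact ⟨he.edge_mem, (he.eq_or_eq_of_isLink (hst e he.edge_mem)).imp Eq.symm Eq.symm⟩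
    · rintro ⟨he, rfl | rfl⟩
      · exact (hst e he).inc_left
      · exact (hst e he).inc_right
  rw [degree, h1, Set.ncard_empty, add_zero, h2, Set.ncard_coe_finset, Finset.card_filter]
  push_cast
  refine Finset.sum_congr rfl fun e he => ?_
  have h3 : s e ≠ t e := (hst e ((hF e).1 he)).ne
  by_cases hs : s e = v <;> by_cases ht : t e = v
  · exact absurd (hs.trans ht.symm) h3
  all_goals simp [ind_singleton, hs, ht]

lemma ncard_edgeCut_eq [DecidableEq α] {G : Graph α β} {s t : β → α} {F : Finset β}
    (hF : ∀ e, e ∈ F ↔ e ∈ E(G)) (hst : ∀ e ∈ E(G), G.IsLink e (s e) (t e)) (A : Finset α) :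
    ((G.edgeCut A).ncard : ℤ) = cutSize F s t A := by
  have h1 : G.edgeCut A = ({e ∈ F | ¬ ind A (s e) = ind A (t e)} : Finset β) := by
    ext e
    simp only [edgeCut, Finset.coe_filter, Set.mem_ofPred_eq, hF, ind_eq_ind_iff, Finset.mem_coe]
    constructor
    · rintro ⟨x, y, he, hx, hy⟩
      refine ⟨he.edge_mem, ?_⟩
      rcases (hst e he.edge_mem).eq_and_eq_or_eq_and_eq he with ⟨rfl, rfl⟩ | ⟨rfl, rfl⟩ <;> tauto
    · rintro ⟨he, h⟩
      by_cases hs : s e ∈ A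
      · exact ⟨s e, t e, hst e he, hs, by tauto⟩
      · exact ⟨t e, s e, (hst e he).symm, by tauto, hs⟩
  rw [h1, Set.ncard_coe_finset, Finset.card_filter, cutSize]
  push_cast
  refine Finset.sum_congr rfl fun e _ => ?_
  rcases ind_cases A (s e) with h | h <;> rcases ind_cases A (t e) with h' | h' <;> simp [h, h']

/-- Deleting the edges that do not cross `X` leaves a bipartite spanning subgraph. Applied to a
maximum cut, this bounds the size of `M` from below. -/
lemma bipartiteIndex_le_card [DecidableEq α] {G : Graph α β} {s t : β → α} {S : Finset α}
    {F : Finset β} (hS : ∀ v, v ∈ S ↔ v ∈ V(G)) (hF : ∀ e, e ∈ F ↔ e ∈ E(G))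
    (hst : ∀ e ∈ E(G), G.IsLink e (s e) (t e)) {X : Finset α} (hX : X ⊆ S) :
    G.bipartiteIndex ≤ {e ∈ F | ind X (s e) = ind X (t e)}.card := by
  refine Nat.sInf_le ⟨G.restrict {e | ¬ ind X (s e) = ind X (t e)}, ⟨restrict_le, rfl⟩,
    ⟨X, S \ X, ?_, ?_, ?_⟩, ?_⟩
  · exact Set.disjoint_sdiff_right
  · rw [← Finset.coe_sdiff, ← Finset.coe_union, Finset.union_sdiff_of_subset hX]
    ext v
    simp [hS]
  · rintro e x y he
    rw [restrict_isLink] at he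
    obtain ⟨heX, he⟩ := he
    have hx := (hS x).2 he.left_mem
    have hy := (hS y).2 he.right_mem
    have h1 : ¬ (x ∈ X ↔ y ∈ X) := by
      simp only [Set.mem_ofPred_eq, ind_eq_ind_iff] at heX
      rcases (hst e he.edge_mem).eq_and_eq_or_eq_and_eq he with ⟨rfl, rfl⟩ | ⟨rfl, rfl⟩ <;> tauto
    simp only [Finset.mem_coe, Set.mem_sdiff]
    tauto
  · rw [← Set.ncard_coe_finset]
    congr 1
    ext e
    simp [hF]

end Graph

theorem mainTheorem10 {α β : Type*} (G : Graph α β) (hV : V(G).Finite) (hE : E(G).Finite)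
    (hloop : G.Loopless) (hnb : ¬ G.IsBipartite)
    (k : ℕ) (hk : 3 ≤ k) (f : α → ZMod k)
    (hf : Even k → Even (∑ᶠ v ∈ V(G), (f v).val))
    (hodd : Odd k → k - 1 ≤ G.bipartiteIndex)
    (heven : Even k → k / 2 - 1 ≤ G.bipartiteIndex)
    (hconn : G.IsEdgeConnected (6 * k - 7)) :
    ∃ H : Graph α β, G.IsFactorMod f H ∧
      (Even k → ∀ v ∈ V(G),
        (⌊(G.degree v : ℚ) / 2⌋ : ℚ) - k - (k : ℚ) / 4 + 1 / 4 ≤ (H.degree v : ℚ) ∧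
        (H.degree v : ℚ) ≤ (⌈(G.degree v : ℚ) / 2⌉ : ℚ) + k + (k : ℚ) / 4 - 1 / 4) ∧
      (Odd k → ∀ v ∈ V(G),
        (⌊(G.degree v : ℚ) / 2⌋ : ℚ) - 3 * (k : ℚ) / 2 ≤ (H.degree v : ℚ) ∧
        (H.degree v : ℚ) ≤ (⌈(G.degree v : ℚ) / 2⌉ : ℚ) + 3 * (k : ℚ) / 2) := by
  classical
  have : NeZero k := ⟨by omega⟩
  -- The graph without vertices is bipartite, hence excluded.
  have hVne : V(G).Nonempty := by
    by_contra hc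
    rw [Set.not_nonempty_iff_eq_empty] at hc
    refine hnb ⟨∅, ∅, by simp, by simp [hc], fun e x y he => ?_⟩
    have := he.left_mem
    simp [hc] at this
  have : Nonempty α := ⟨hVne.some⟩
  have hends : ∀ e, ∃ x y, e ∈ E(G) → G.IsLink e x y := fun e => by
    by_cases he : e ∈ E(G)
    · obtain ⟨x, y, h⟩ := G.exists_isLink_of_mem_edgeSet he
      exact ⟨x, y, fun _ => h⟩
    · exact ⟨hVne.some, hVne.some, fun h => absurd h he⟩
  choose s t hst using hends
  have hS : ∀ v, v ∈ hV.toFinset ↔ v ∈ V(G) := fun v => hV.mem_toFinset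
  have hF : ∀ e, e ∈ hE.toFinset ↔ e ∈ E(G) := fun e => hE.mem_toFinset
  obtain ⟨m, hm, hkm⟩ : ∃ m : ℕ, m - 1 ≤ G.bipartiteIndex ∧ (k = m ∧ Odd k ∨ k = 2 * m) := by
    rcases Nat.even_or_odd' k with ⟨m, h | h⟩
    · exact ⟨m, by have := heven ⟨m, by omega⟩; omega, Or.inr h⟩
    · exact ⟨k, hodd ⟨m, h⟩, Or.inl ⟨rfl, m, h⟩⟩
  obtain ⟨ρ, hρ, hbal⟩ := exists_signs_of_edgeConnected (k := k) (m := m) (S := hV.toFinset)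
    (F := hE.toFinset) (s := s) (t := t) (by exact_mod_cast hk) (by omega)
    (by
      rcases hkm with ⟨h1, h2⟩ | h1
      · left; exact ⟨by exact_mod_cast h1, by exact_mod_cast h2⟩
      · right; exact_mod_cast h1)
    (fun e he => (hS _).2 (hst e ((hF e).1 he)).left_mem)
    (fun e he => (hS _).2 (hst e ((hF e).1 he)).right_mem)
    (fun e he => (hst e ((hF e).1 he)).ne)
    (fun A hA hne hAS => by
      rw [← Graph.ncard_edgeCut_eq hF hst]
      have := hconn A (fun v hv => (hS v).1 (hA hv)) hne (fun hc => hAS (by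
        ext v; rw [hS, ← hc, Finset.mem_coe]))
      omega)
    (fun v => ((f v).val : ℤ))
    (fun hk2 => by
      have h1 := hf ⟨m, by omega⟩
      rw [finsum_mem_eq_finite_toFinset_sum _ hV] at h1
      exact_mod_cast h1.two_dvd)
    (fun X hX => by
      have := Graph.bipartiteIndex_le_card hS hF hst hX
      omega)
  obtain ⟨H, hH⟩ : ∃ H, H = G.restrict {e | ρ e = 1} := ⟨_, rfl⟩
  have hHG : H ≤ G := hH ▸ Graph.restrict_le
  have hHE : ∀ e, e ∈ {e ∈ hE.toFinset | ρ e = 1} ↔ e ∈ E(H) := fun e => by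
    simp [hH]
  have key : ∀ v ∈ V(G), (k : ℤ) ∣ (H.degree v : ℤ) - (f v).val ∧
      |2 * (H.degree v : ℤ) - G.degree v| ≤ 2 * k - 1 + m := fun v hv => by
    obtain ⟨h1, h2⟩ := hbal v ((hS v).2 hv)
    have h3 := Graph.degree_eq_sum hloop hF hst v
    have h4 := Graph.degree_eq_sum (hloop.anti hHG) hHE
      (fun e he => by
        have := (hHE e).2 he
        simp only [Finset.mem_filter, hF] at this
        rw [hH, Graph.restrict_isLink]
        exact ⟨this.2, hst e this.1⟩) v
    have h5 : ∑ e ∈ hE.toFinset, ρ e * (ind {v} (s e) + ind {v} (t e)) =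
        2 * (H.degree v : ℤ) - G.degree v := by
      rw [h3, h4, Finset.sum_filter, Finset.mul_sum, ← Finset.sum_sub_distrib]
      refine Finset.sum_congr rfl fun e _ => ?_
      rcases hρ e with h | h <;> simp [h]; ring
    rw [h5, ← h3] at h1
    rw [h5] at h2
    refine ⟨?_, h2⟩
    -- The modulus `2k` lets the factor 2 be cancelled even when `k` is even.
    rw [show 2 * (H.degree v : ℤ) - G.degree v - (2 * ((f v).val : ℤ) - G.degree v) =
      2 * ((H.degree v : ℤ) - (f v).val) by ring] at h1
    exact (mul_dvd_mul_iff_left two_ne_zero).1 h1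
  have bounds : ∀ v ∈ V(G), (⌊(G.degree v : ℚ) / 2⌋ : ℚ) - (2 * k - 1 + m) / 2 ≤ H.degree v ∧
      (H.degree v : ℚ) ≤ (⌈(G.degree v : ℚ) / 2⌉ : ℚ) + (2 * k - 1 + m) / 2 := fun v hv => by
    obtain ⟨h1, h2⟩ := abs_le.1 (key v hv).2
    have h1' : (-(2 * k - 1 + m) : ℚ) ≤ 2 * H.degree v - G.degree v := by exact_mod_cast h1
    have h2' : (2 * H.degree v - G.degree v : ℚ) ≤ 2 * k - 1 + m := by exact_mod_cast h2
    have h3 := Int.floor_le ((G.degree v : ℚ) / 2)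
    have h4 := Int.le_ceil ((G.degree v : ℚ) / 2)
    constructor <;> linarith
  refine ⟨H, ⟨⟨hHG, by rw [hH]; rfl⟩, fun v hv => ?_⟩, fun hke v hv => ?_, fun hko v hv => ?_⟩
  · have h1 := (ZMod.intCast_eq_intCast_iff_dvd_sub ((f v).val : ℤ) (H.degree v : ℤ) k).2
      (key v hv).1
    push_cast at h1
    rw [← h1, ZMod.natCast_zmod_val]
  · have hk2 : (k : ℚ) = 2 * m := by
      rcases hkm with ⟨-, h⟩ | h
      · exact absurd hke (Nat.not_even_iff_odd.2 h)
      · exact_mod_cast h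
    obtain ⟨h1, h2⟩ := bounds v hv
    constructor <;> linarith
  · have hk2 : (k : ℚ) = m := by
      rcases hkm with ⟨h, -⟩ | h
      · exact_mod_cast h
      · exact absurd ⟨m, by omega⟩ (Nat.not_even_iff_odd.2 hko)
    obtain ⟨h1, h2⟩ := bounds v hv
    constructor <;> linarith
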